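/- Let $m>1$ be an integer and $\Sigma=\{\alpha_1,\dots,\alpha_m\}\cup\{\beta_1,\dots,\beta_m\}$. Let $M$ be the Dyck monoid, i.e. the monoid with zero generated by $\Sigma$ subject to the relations $\alpha_j\beta_j\equiv 1$ for all $j$ and $\alpha_i\beta_j\equiv 0$ for $i\neq j$, and let $$X=\{x\in\Sigma^{\mathbb Z} : x_r x_{r+1}\cdots x_l\not\equiv 0 \ (\mathrm{mod}\ M)\ \text{for all integers } r\le l\}$$ be the two-sided $m$-Dyck shift. The double-tail relation of $X$ is $$\mathcal T_2=\{(x,x')\in X\times X : \exists n\ge 0\ \forall |k|>n\ \ x_k=x'_k\}.$$ A $\mathcal T_2$-holonomy is an injective Borel map $g:A\to g(A)$, with $A\subseteq X$ a Borel set, such that $(x,g(x))\in\mathcal T_2$ for every $x\in A$. A Borel probability $\mu$ on $X$ is called $\mathcal T_2$-invariant if $\mu(A)=\mu(g(A))$ for every $\mathcal T_2$-holonomy $g:A\to g(A)$. For $z\in\{0,1\}^{\mathbb Z}$ let $\tilde H_0(z)=0$, $\tilde H_i(z)=\sum_{j=0}^{i-1}(\delta_{1,z_j}-\delta_{0,z_j})$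 for $i>0$ and $\tilde H_i(z)=\sum_{j=i}^{-1}(\delta_{0,z_j}-\delta_{1,z_j})$ for $i<0$. Let $$S=\{z\in\{0,1\}^{\mathbb Z} : \liminf_{n\to+\infty}\tilde H_n(z)=-\infty,\ \liminf_{n\to-\infty}\tilde H_n(z)=-\infty\}.$$ For $z\in S$ put $\gamma_k(z)=\sum_{i=0}^{k}z_i$ if $k\ge 0$, $\gamma_k(z)=-\sum_{i=k}^{-1}z_i$ if $k<0$, and $\varepsilon_n(z)=\max\{l<n : \tilde H_l(z)\le\tilde H_{n+1}(z)\}$. Define $F:S\times\{1,\dots,m\}^{\mathbb Z}\to\Sigma^{\mathbb Z}$ by $F(z,a)_n=\alpha_j$ if $z_n=1$ and $a_{\gamma_n(z)}=j$, and $F(z,a)_n=\beta_j$ if $z_n=0$ and $a_{\gamma_k(z)}=j$, where $k=\varepsilon_n(z)$. Let $\mu_1$ and $\mu_2$ be the symmetric (uniform) product probability measures on $\{0,1\}^{\mathbb Z}$ and on $\{1,\dots,m\}^{\mathbb Z}$, respectively, and let $\tilde\mu=(\mu_1\times\mu_2)\circ F^{-1}$. Then $\tilde\mu$ is a probability measure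 with $\tilde\mu(X)=1$, and it is $\mathcal T_2$-invariant. -/

import Mathlib

open MeasureTheory Filter

/-! ### The double-tail (homoclinic) relation -/

/-- The double-tail relation of `X ⊆ S^ℤ`: two points of `X` that agree at all coordinates
of large absolute value. -/
def DoubleTail {S : Type*} (X : Set (ℤ → S)) (x x' : ℤ → S) : Prop :=
  x ∈ X ∧ x' ∈ X ∧ ∃ n : ℕ, ∀ k : ℤ, (n : ℤ) < |k| → x k = x' k

/-- `g : A → g(A)` is a holonomy of the double-tail relation of `X`: `A` is Borel, `g` is Borel
and injective on `A`, and `(x, g x)` is in the relation for every `x ∈ A` (so `A ⊆ X`).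
The values of `g` outside `A` play no role. -/
structure IsDoubleTailHolonomy {S : Type*} [MeasurableSpace S] (X A : Set (ℤ → S))
    (g : (ℤ → S) → (ℤ → S)) : Prop where
  measurableSet : MeasurableSet A
  measurable : Measurable (A.domRestrict g)
  injOn : Set.InjOn g A
  rel : ∀ x ∈ A, DoubleTail X x (g x)

/-- `μ` is a probability measure on `X` (as a measure on `S^ℤ` giving full mass to `X`) that is
preserved by all holonomies of the double-tail relation of `X`. -/
structure IsDoubleTailInvariantProbability {S : Type*} [MeasurableSpace S] (X : Set (ℤ → S))
    (μ : Measure (ℤ → S)) : Prop where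
  isProbabilityMeasure : IsProbabilityMeasure μ
  measure_eq_one : μ X = 1
  measure_image : ∀ (A : Set (ℤ → S)) (g : (ℤ → S) → (ℤ → S)),
    IsDoubleTailHolonomy X A g → μ A = μ (g '' A)

/-! ### The Dyck shift -/

/-- The alphabet `{α_1, …, α_m} ∪ {β_1, …, β_m}`: `Sum.inl j` is the opening bracket `α_j` and
`Sum.inr j` is the closing bracket `β_j`. -/
abbrev DyckAlphabet (m : ℕ) : Type := Fin m ⊕ Fin m

/-- A word, as an element of the free monoid with zero on the alphabet. -/
def dyckWord {m : ℕ} (w : List (DyckAlphabet m)) : WithZero (FreeMonoid (DyckAlphabet m)) :=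
  ((FreeMonoid.ofList w : FreeMonoid (DyckAlphabet m)) : WithZero (FreeMonoid (DyckAlphabet m)))

/-- The defining relations of the Dyck monoid: `α_j β_j = 1`, and `α_i β_j = 0` for `i ≠ j`. -/
inductive DyckRel (m : ℕ) : WithZero (FreeMonoid (DyckAlphabet m)) →
    WithZero (FreeMonoid (DyckAlphabet m)) → Prop
  | cancel (j : Fin m) : DyckRel m (dyckWord [Sum.inl j, Sum.inr j]) 1
  | zero (i j : Fin m) (h : i ≠ j) : DyckRel m (dyckWord [Sum.inl i, Sum.inr j]) 0

/-- Congruence modulo the Dyck monoid `M`; `M` is the quotient of the free monoid with zero by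
this congruence. -/
def dyckCon (m : ℕ) : Con (WithZero (FreeMonoid (DyckAlphabet m))) :=
  conGen (DyckRel m)

/-- The Dyck language: the words that are not congruent to `0`. -/
def dyckLanguage (m : ℕ) : Set (List (DyckAlphabet m)) :=
  {w | ¬ dyckCon m (dyckWord w) 0}

/-- The block `x_r x_{r+1} ⋯ x_l` (for `r ≤ l`). -/
def block {S : Type*} (x : ℤ → S) (r l : ℤ) : List S :=
  (List.range (l + 1 - r).toNat).map fun i => x (r + i)

/-- The two-sided Dyck shift. -/
def dyckShift (m : ℕ) : Set (ℤ → DyckAlphabet m) :=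
  {x | ∀ r l : ℤ, r ≤ l → block x r l ∈ dyckLanguage m}

/-! ### The bracket-matching map and the measure -/

/-- The height cocycle of a `0`-`1` sequence (`1` is a step up, `0` is a step down). -/
noncomputable def height (z : ℤ → Fin 2) (i : ℤ) : ℤ :=
  if 0 < i then
    ∑ j ∈ Finset.Ico 0 i, ((if z j = 1 then 1 else 0) - (if z j = 0 then 1 else 0))
  else if i < 0 then
    ∑ j ∈ Finset.Ico i 0, ((if z j = 0 then 1 else 0) - (if z j = 1 then 1 else 0))
  else 0

/-- The sequences whose height has lower limit `-∞` in both directions. -/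
def balancedSet : Set (ℤ → Fin 2) :=
  {z | liminf (fun n : ℤ => ((height z n : ℝ) : EReal)) atTop = ⊥ ∧
       liminf (fun n : ℤ => ((height z n : ℝ) : EReal)) atBot = ⊥}

/-- The signed number of ones between the origin and the position `k`. -/
noncomputable def onesCount (z : ℤ → Fin 2) (k : ℤ) : ℤ :=
  if 0 ≤ k then ∑ i ∈ Finset.Icc 0 k, ((z i : ℕ) : ℤ)
  else -∑ i ∈ Finset.Icc k (-1), ((z i : ℕ) : ℤ)

/-- `max {l < n : H_l(z) ≤ H_{n+1}(z)}`. The set is bounded above, and for `z ∈ balancedSet`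
it is nonempty, so that the supremum is a maximum. -/
noncomputable def matchPos (z : ℤ → Fin 2) (n : ℤ) : ℤ :=
  sSup {l : ℤ | l < n ∧ height z l ≤ height z (n + 1)}

/-- The bracket-matching map `F`. It is only meant for `z ∈ balancedSet`; its values elsewhere
play no role. -/
noncomputable def bracketMap (m : ℕ) (p : (ℤ → Fin 2) × (ℤ → Fin m)) : ℤ → DyckAlphabet m :=
  fun n =>
    if p.1 n = 1 then Sum.inl (p.2 (onesCount p.1 n))
    else Sum.inr (p.2 (onesCount p.1 (matchPos p.1 n)))

/-- The symmetric product measure on `{1, …, k}^ℤ`. -/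
noncomputable def symmetricProduct (k : ℕ) [NeZero k] : Measure (ℤ → Fin k) :=
  Measure.infinitePi fun _ : ℤ => (PMF.uniformOfFintype (Fin k)).toMeasure

/-- The image of `μ₁ × μ₂` under the map `F`, whose domain is `balancedSet × {1, …, m}^ℤ`. -/
noncomputable def dyckMeasure (m : ℕ) [NeZero m] : Measure (ℤ → DyckAlphabet m) :=
  (((symmetricProduct 2).prod (symmetricProduct m)).restrict
    (balancedSet ×ˢ Set.univ)).map (bracketMap m)

/-! ### Heights and counts of ones -/

/-! Under `dyckMeasure` the bracket types form a fair random walk. Given the walk, each opening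
bracket carries an independent uniform label, which its matching closing bracket repeats. The walk
is recurrent, so almost surely every closing bracket has a partner.

The invariance rests on exchanging excursions, that is, balanced blocks of brackets. An excursion of
length N uses N/2 labels, none of which is read outside it, and it leaves the matching outside
unchanged. Replacing it by another excursion on the same interval therefore preserves both the
probability of the types and the conditional probability of the labels
(`symmetricProduct_reading_excursion`, `dyckMeasure_exchange`). This passes from cylinders to Borel
sets in `dyckMeasure_image_exchange`.

It remains to see that equivalent points almost surely differ by such an exchange
(`DoubleTail.exchangeRel_or_mem`). Far out, their heights differ by constants, one on the left and
one on the right. If the constants coincide, a long excursion of both points covers all the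
differences. If they do not, the same brackets are matched with a shift of height, and consistency
of the labels in both points makes the stack of open labels eventually periodic. For m > 1 this is a
null event (`dyckMeasure_periodicStackSet`). A holonomy is thus, up to null sets, a countable union
of exchanges of fixed words (`dyckMeasure_image_eq`).

That the measure lives on the Dyck shift follows from an action of the Dyck monoid on infinite
stacks: a word on which some stack survives cannot be zero. -/

lemma fin_two_ne_one {i : Fin 2} : i ≠ 1 ↔ i = 0 := by
  fin_cases i <;> simp

lemma height_succ (z : ℤ → Fin 2) (n : ℤ) :
    height z (n + 1) = height z n + if z n = 1 then 1 else -1 := by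
  have key : ((if z n = 1 then 1 else 0) - (if z n = 0 then 1 else 0) : ℤ)
      = if z n = 1 then 1 else -1 := by
    rcases eq_or_ne (z n) 1 with h | h
    · simp [h]
    · rw [fin_two_ne_one] at h
      simp [h]
  rcases lt_trichotomy n 0 with h | h | h
  · have h1 : Finset.Ico n 0 = insert n (Finset.Ico (n + 1) 0) := by
      ext j
      simp only [Finset.mem_Ico, Finset.mem_insert]
      omega
    have h2 : height z n = ∑ j ∈ Finset.Ico n 0,
        ((if z j = 0 then 1 else 0) - (if z j = 1 then 1 else 0) : ℤ) := by
      rw [height, if_neg (by omega), if_pos h]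
    have h3 : height z (n + 1) = ∑ j ∈ Finset.Ico (n + 1) 0,
        ((if z j = 0 then 1 else 0) - (if z j = 1 then 1 else 0) : ℤ) := by
      rw [height, if_neg (by omega)]
      split_ifs with h4
      · rfl
      · rw [Finset.Ico_eq_empty (by omega)]
        simp
    rw [h2, h3, h1, Finset.sum_insert (by simp), ← key]
    ring
  · subst h
    have h1 : Finset.Ico (0 : ℤ) 1 = {0} := by
      ext j
      simp only [Finset.mem_Ico, Finset.mem_singleton]
      omega
    simp only [zero_add, height, h1, zero_lt_one, if_true, Finset.sum_singleton, lt_irrefl,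
      if_false]
    exact key
  · have h1 : Finset.Ico 0 (n + 1) = insert n (Finset.Ico 0 n) := by
      ext j
      simp only [Finset.mem_Ico, Finset.mem_insert]
      omega
    rw [height, if_pos (by omega), height, if_pos h, h1, Finset.sum_insert (by simp), key, add_comm]

lemma height_zero (z : ℤ → Fin 2) : height z 0 = 0 := by simp [height]

lemma height_succ_of_one {z : ℤ → Fin 2} {n : ℤ} (h : z n = 1) :
    height z (n + 1) = height z n + 1 := by rw [height_succ, if_pos h]

lemma height_succ_of_ne {z : ℤ → Fin 2} {n : ℤ} (h : z n ≠ 1) :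
    height z (n + 1) = height z n - 1 := by rw [height_succ, if_neg h]; ring

lemma height_le_succ_add (z : ℤ → Fin 2) (n : ℤ) : height z n ≤ height z (n + 1) + 1 := by
  rw [height_succ]; split_ifs <;> omega

lemma height_succ_le (z : ℤ → Fin 2) (n : ℤ) : height z (n + 1) ≤ height z n + 1 := by
  rw [height_succ]; split_ifs <;> omega

lemma one_of_height_lt {z : ℤ → Fin 2} {n : ℤ} (h : height z n < height z (n + 1)) : z n = 1 := by
  by_contra h1
  rw [height_succ_of_ne h1] at h
  omega

lemma ne_one_of_height_lt {z : ℤ → Fin 2} {n : ℤ} (h : height z (n + 1) < height z n) :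
    z n ≠ 1 := by
  intro h1
  rw [height_succ_of_one h1] at h
  omega

/-- Height increments over an interval only depend on the symbols there. -/
lemma height_sub_congr {z z' : ℤ → Fin 2} {p q : ℤ} (hpq : p ≤ q)
    (h : ∀ j, p ≤ j → j < q → z j = z' j) :
    height z q - height z p = height z' q - height z' p := by
  induction q, hpq using Int.leInduction with
  | base => simp
  | succ q hq ih =>
    have := ih fun j h1 h2 => h j h1 (by omega)
    rw [height_succ, height_succ, h q hq (by omega)]
    omega

lemma onesCount_lt {z : ℤ → Fin 2} {i j : ℤ} (hij : i < j) (hi : z i = 1) (hj : z j = 1) :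
    onesCount z i < onesCount z j := by
  have nn : ∀ k, (0 : ℤ) ≤ ((z k : ℕ) : ℤ) := fun k => by positivity
  have single : ∀ (s : Finset ℤ) (k : ℤ), k ∈ s → z k = 1 →
      (1 : ℤ) ≤ ∑ i ∈ s, ((z i : ℕ) : ℤ) := fun s k hk hz => by
    have := Finset.single_le_sum (f := fun i => ((z i : ℕ) : ℤ)) (fun i _ => nn i) hk
    simpa [hz] using this
  have strict : ∀ (s t : Finset ℤ) (k : ℤ), s ⊆ t → k ∈ t → k ∉ s → z k = 1 →
      ∑ i ∈ s, ((z i : ℕ) : ℤ) < ∑ i ∈ t, ((z i : ℕ) : ℤ) := fun s t k hst hk hks hz =>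
    Finset.sum_lt_sum_of_subset hst hk hks (by simp [hz]) fun i _ _ => nn i
  unfold onesCount
  split_ifs with h1 h2 h2
  · refine strict _ _ j (Finset.Icc_subset_Icc le_rfl hij.le) ?_ ?_ hj <;>
      simp only [Finset.mem_Icc] <;> omega
  · omega
  · have a := single (Finset.Icc i (-1)) i (by simp only [Finset.mem_Icc]; omega) hi
    have b := single (Finset.Icc 0 j) j (by simp only [Finset.mem_Icc]; omega) hj
    omega
  · refine neg_lt_neg (strict _ _ i (Finset.Icc_subset_Icc hij.le le_rfl) ?_ ?_ hi) <;>
      simp only [Finset.mem_Icc] <;> omega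

/-- Distinct opening brackets read distinct coordinates of the label sequence; this is the source of
their independence. -/
lemma onesCount_injOn (z : ℤ → Fin 2) : Set.InjOn (onesCount z) {n | z n = 1} := by
  intro i hi j hj h
  rcases lt_trichotomy i j with h1 | h1 | h1
  · exact absurd h (onesCount_lt h1 hi hj).ne
  · exact h1
  · exact absurd h (onesCount_lt h1 hj hi).ne'

/-! ### The set of balanced sequences -/

lemma liminf_intCast_eq_bot_iff (f : ℤ → ℤ) (l : Filter ℤ) :
    liminf (fun n => ((f n : ℝ) : EReal)) l = ⊥ ↔ ∀ h : ℤ, ∃ᶠ n in l, f n ≤ h := by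
  constructor
  · intro H h
    have h1 : liminf (fun n => ((f n : ℝ) : EReal)) l < ((h : ℝ) : EReal) := by
      rw [H]; exact EReal.bot_lt_coe _
    refine (frequently_lt_of_liminf_lt (by isBoundedDefault) h1).mono fun n hn => ?_
    exact_mod_cast hn.le
  · intro H
    rw [EReal.eq_bot_iff_forall_lt]
    intro y
    obtain ⟨k, hk⟩ := exists_int_lt y
    refine lt_of_le_of_lt (liminf_le_of_frequently_le ((H k).mono fun n hn => ?_)
      (by isBoundedDefault)) (show ((k : ℝ) : EReal) < y by exact_mod_cast hk)
    exact_mod_cast hn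

lemma mem_balancedSet_iff (z : ℤ → Fin 2) :
    z ∈ balancedSet ↔ (∀ h N : ℤ, ∃ n ≥ N, height z n ≤ h) ∧
      (∀ h N : ℤ, ∃ n ≤ N, height z n ≤ h) := by
  unfold balancedSet
  rw [Set.mem_ofPred_eq, liminf_intCast_eq_bot_iff, liminf_intCast_eq_bot_iff]
  simp only [frequently_atTop, frequently_atBot]

lemma measurable_height (n : ℤ) : Measurable fun z : ℤ → Fin 2 => height z n := by
  have h : ∀ (j : ℤ) (c : Fin 2), Measurable fun z : ℤ → Fin 2 => (if z j = c then 1 else 0 : ℤ) :=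
    fun j c => (measurable_of_countable (fun a : Fin 2 => (if a = c then 1 else 0 : ℤ))).comp
      (measurable_pi_apply j)
  unfold height
  split_ifs
  · exact Finset.measurable_sum _ fun j _ => (h j 1).sub (h j 0)
  · exact Finset.measurable_sum _ fun j _ => (h j 0).sub (h j 1)
  · exact measurable_const

lemma measurable_onesCount (n : ℤ) : Measurable fun z : ℤ → Fin 2 => onesCount z n := by
  have h : ∀ (j : ℤ), Measurable fun z : ℤ → Fin 2 => ((z j : ℕ) : ℤ) :=
    fun j => (measurable_of_countable (fun a : Fin 2 => ((a : ℕ) : ℤ))).comp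
      (measurable_pi_apply j)
  unfold onesCount
  split_ifs
  · exact Finset.measurable_sum _ fun j _ => h j
  · exact (Finset.measurable_sum _ fun j _ => h j).neg

lemma measurableSet_balancedSet : MeasurableSet balancedSet := by
  have h : balancedSet = {z | (∀ h N : ℤ, ∃ n, n ≥ N ∧ height z n ≤ h) ∧
      (∀ h N : ℤ, ∃ n, n ≤ N ∧ height z n ≤ h)} := Set.ext mem_balancedSet_iff
  rw [h]
  have hm := fun n h => measurableSet_setOfPred.1 (measurableSet_le (measurable_height n)
    (measurable_const (a := h)))
  refine measurableSet_setOfPred.2 (Measurable.and ?_ ?_)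
  all_goals
    refine Measurable.forall fun h => Measurable.forall fun N => Measurable.exists fun n => ?_
    exact (measurable_const).and (hm n h)

/-! ### Recurrence of the simple random walk -/

/-- Sums of independent centred random signs are unbounded below. -/
lemma ae_not_bddBelow_sum_signs {Ω : Type*} [MeasurableSpace Ω] {μ : Measure Ω}
    [IsProbabilityMeasure μ] {ξ : ℕ → Ω → ℝ} (hmeas : ∀ n, Measurable (ξ n))
    (hindep : ProbabilityTheory.iIndepFun ξ μ) (habs : ∀ n ω, |ξ n ω| = 1)
    (hmean : ∀ n, ∫ ω, ξ n ω ∂μ = 0) :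
    ∀ᵐ ω ∂μ, ¬ BddBelow (Set.range fun n => ∑ k ∈ Finset.range (n + 1), ξ k ω) := by
  have hsm := fun n => (hmeas n).stronglyMeasurable
  have hintegrable : ∀ n, Integrable (ξ n) μ := fun n =>
    Integrable.of_bound (hsm n).aestronglyMeasurable 1 (ae_of_all _ fun ω => (habs n ω).le)
  let ℱ := Filtration.natural ξ hsm
  let f : ℕ → Ω → ℝ := fun n ω => ∑ k ∈ Finset.range (n + 1), ξ k ω
  have hdiff : ∀ n, f (n + 1) - f n = ξ (n + 1) := fun n => by
    funext ω
    simp [f, Finset.sum_range_succ _ (n + 1)]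
  have hadapt : StronglyAdapted ℱ f := fun n =>
    Finset.stronglyMeasurable_fun_sum _ fun k hk =>
      ((Filtration.stronglyAdapted_natural hsm) k).mono
        (ℱ.mono (Nat.lt_succ_iff.1 (Finset.mem_range.1 hk)))
  have hmart : Martingale f ℱ μ := by
    refine martingale_of_condExp_sub_eq_zero_nat hadapt
      (fun n => integrable_finsetSum _ fun k _ => hintegrable k) fun n => ?_
    rw [hdiff]
    refine (hindep.condExp_natural_ae_eq_of_lt hsm (Nat.lt_succ_self n)).trans ?_
    exact ae_of_all _ fun ω => hmean _
  have hb : ∀ᵐ ω ∂μ, ∀ i, |f (i + 1) ω - f i ω| ≤ (1 : NNReal) := ae_of_all _ fun ω i => by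
    have := congrFun (hdiff i) ω
    simp only [Pi.sub_apply] at this
    rw [this, habs]
    simp
  -- For a martingale with bounded increments, bounded below implies bounded above, which implies
  -- convergence. Steps of absolute value 1 rule that out.
  filter_upwards [hmart.bddAbove_range_iff_bddBelow_range hb,
    hmart.submartingale.bddAbove_iff_exists_tendsto hb] with ω h1 h2 h3
  obtain ⟨c, hc⟩ := h2.1 (h1.2 h3)
  have h4 : Tendsto (fun n => |f (n + 1) ω - f n ω|) atTop (nhds |c - c|) :=
    ((hc.comp (tendsto_add_atTop_nat 1)).sub hc).abs
  have h5 : ∀ n, |f (n + 1) ω - f n ω| = 1 := fun n => by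
    have := congrFun (hdiff n) ω
    simp only [Pi.sub_apply] at this
    rw [this, habs]
  simp only [h5, sub_self, abs_zero] at h4
  exact one_ne_zero (tendsto_nhds_unique tendsto_const_nhds h4)

instance symmetricProduct.instIsProbabilityMeasure (k : ℕ) [NeZero k] :
    IsProbabilityMeasure (symmetricProduct k) := by
  unfold symmetricProduct; infer_instance

lemma uniform_toMeasure_singleton (k : ℕ) [NeZero k] (a : Fin k) :
    (PMF.uniformOfFintype (Fin k)).toMeasure {a} = (k : ENNReal)⁻¹ := by
  rw [PMF.toMeasure_apply_singleton _ _ (measurableSet_singleton a)]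
  simp

/-- The index map and the sign are left free so that the walk can be followed both forwards and
backwards in time. -/
lemma ae_not_bddBelow_sum_symmetricProduct {e : ℕ → ℤ} (he : Function.Injective e)
    (ε : Fin 2 → ℝ) (h1 : |ε 1| = 1) (h0 : ε 0 = - ε 1) :
    ∀ᵐ z ∂symmetricProduct 2,
      ¬ BddBelow (Set.range fun n => ∑ k ∈ Finset.range (n + 1), ε (z (e k))) := by
  have hε : Measurable ε := measurable_of_countable _
  refine ae_not_bddBelow_sum_signs (fun n => hε.comp (measurable_pi_apply _)) ?_ ?_ ?_
  · have := ProbabilityTheory.iIndepFun_infinitePi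
      (P := fun _ : ℤ => (PMF.uniformOfFintype (Fin 2)).toMeasure)
      (X := fun _ : ℤ => ε) (fun _ => hε)
    exact this.precomp he
  · intro n z
    rcases eq_or_ne (z (e n)) 1 with h | h
    · rw [h, h1]
    · rw [fin_two_ne_one.1 h, h0, abs_neg, h1]
  · intro n
    have hmp := measurePreserving_eval_infinitePi
      (fun _ : ℤ => (PMF.uniformOfFintype (Fin 2)).toMeasure) (e n)
    have : ∫ z, ε (z (e n)) ∂symmetricProduct 2
        = ∫ a, ε a ∂((PMF.uniformOfFintype (Fin 2)).toMeasure) := by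
      rw [← hmp.map_eq, integral_map hmp.measurable.aemeasurable
        hε.stronglyMeasurable.aestronglyMeasurable]
      rfl
    rw [this, integral_fintype (Integrable.of_finite), Fin.sum_univ_two, h0]
    simp [measureReal_def]

lemma height_natCast (z : ℤ → Fin 2) (n : ℕ) :
    (height z n : ℝ) = ∑ k ∈ Finset.range n, if z (k : ℤ) = 1 then (1 : ℝ) else -1 := by
  induction n with
  | zero => simp [height_zero]
  | succ n ih =>
    rw [Finset.sum_range_succ, ← ih, Nat.cast_succ, height_succ]
    split_ifs <;> simp

lemma height_neg_natCast (z : ℤ → Fin 2) (n : ℕ) :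
    (height z (-n) : ℝ) = ∑ k ∈ Finset.range n, if z (-1 - k : ℤ) = 1 then (-1 : ℝ) else 1 := by
  induction n with
  | zero => simp [height_zero]
  | succ n ih =>
    have h := height_succ z (-1 - n)
    have e1 : (-1 - n + 1 : ℤ) = -n := by ring
    have e2 : (-((n + 1 : ℕ) : ℤ)) = -1 - n := by push_cast; ring
    rw [e1] at h
    rw [Finset.sum_range_succ, ← ih, e2, h]
    split_ifs <;> simp

lemma ae_mem_balancedSet : ∀ᵐ z ∂symmetricProduct 2, z ∈ balancedSet := by
  filter_upwards [ae_not_bddBelow_sum_symmetricProduct (e := fun k => (k : ℤ))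
      Nat.cast_injective (fun a => if a = 1 then 1 else -1) (by simp) (by simp),
    ae_not_bddBelow_sum_symmetricProduct (e := fun k => (-1 - k : ℤ))
      (fun a b h => by simpa using h) (fun a => if a = 1 then -1 else 1) (by simp) (by simp)]
    with z hz1 hz2
  have fin : ∀ s : Finset ℤ, ∃ c : ℤ, ∀ n ∈ s, c < height z n := fun s => by
    obtain ⟨c, hc⟩ := (s.image (height z)).bddBelow
    exact ⟨c - 1, fun n hn => by
      have := hc (Finset.mem_coe.2 (Finset.mem_image_of_mem _ hn)); omega⟩
  rw [mem_balancedSet_iff]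
  constructor
  · intro h N
    obtain ⟨c, hc⟩ := fin (Finset.Icc 0 N)
    by_contra! H
    -- `c` bounds the heights up to time `N`, and `h` the later ones.
    refine hz1 ⟨(min c h : ℤ), ?_⟩
    rintro _ ⟨n, rfl⟩
    simp only
    rw [← height_natCast]
    norm_cast
    rcases lt_or_ge ((n + 1 : ℕ) : ℤ) N with h1 | h1
    · exact (min_le_left _ _).trans (hc _ (by simp only [Finset.mem_Icc]; omega)).le
    · exact (min_le_right _ _).trans (H _ h1).le
  · intro h N
    obtain ⟨c, hc⟩ := fin (Finset.Icc N 0)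
    by_contra! H
    refine hz2 ⟨(min c h : ℤ), ?_⟩
    rintro _ ⟨n, rfl⟩
    simp only
    rw [← height_neg_natCast]
    norm_cast
    rcases lt_or_ge N (-((n + 1 : ℕ) : ℤ)) with h1 | h1
    · exact (min_le_left _ _).trans (hc _ (by simp only [Finset.mem_Icc]; omega)).le
    · exact (min_le_right _ _).trans (H _ h1).le

section

variable {m : ℕ}

instance DyckAlphabet.instMeasurableSingletonClass (m : ℕ) :
    MeasurableSingletonClass (DyckAlphabet m) where
  measurableSet_singleton _ :=
    measurableSet_sum_iff.2 ⟨(Set.to_countable _).measurableSet, (Set.to_countable _).measurableSet⟩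

/-! ### Action of words on infinite stacks -/

/-- An opening bracket is pushed onto an infinite stack; a closing bracket pops its label, and
fails if another label is on top. -/
def stackStep (s : Stream' (Fin m)) : DyckAlphabet m → Option (Stream' (Fin m))
  | Sum.inl j => some (Stream'.cons j s)
  | Sum.inr j => if s.head = j then some s.tail else none

/-- The action of the free monoid with zero on infinite stacks by partial maps. -/
def stackAct (a : WithZero (FreeMonoid (DyckAlphabet m))) (s : Stream' (Fin m)) :
    Option (Stream' (Fin m)) :=
  WithZero.recZeroCoe (motive := fun _ => Option (Stream' (Fin m))) none
    (fun w => (FreeMonoid.toList w).foldlM stackStep s) a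

lemma stackAct_zero (s : Stream' (Fin m)) : stackAct 0 s = none := rfl

lemma stackAct_dyckWord (w : List (DyckAlphabet m)) (s : Stream' (Fin m)) :
    stackAct (dyckWord w) s = w.foldlM stackStep s := rfl

lemma stackAct_coe (w : FreeMonoid (DyckAlphabet m)) (s : Stream' (Fin m)) :
    stackAct (w : WithZero (FreeMonoid (DyckAlphabet m))) s =
      (FreeMonoid.toList w).foldlM stackStep s := rfl

lemma stackAct_mul (a b : WithZero (FreeMonoid (DyckAlphabet m))) (s : Stream' (Fin m)) :
    stackAct (a * b) s = (stackAct a s).bind (stackAct b) := by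
  induction a using WithZero.recZeroCoe with
  | zero => rw [zero_mul]; rfl
  | coe a =>
    induction b using WithZero.recZeroCoe with
    | zero =>
      rw [mul_zero]
      cases h : stackAct (a : WithZero (FreeMonoid (DyckAlphabet m))) s <;> rfl
    | coe b =>
      rw [← WithZero.coe_mul, stackAct_coe, FreeMonoid.toList_mul, List.foldlM_append]
      rfl

/-- The congruence of words that act in the same way on infinite stacks. -/
def stackCon (m : ℕ) : Con (WithZero (FreeMonoid (DyckAlphabet m))) where
  r a b := stackAct a = stackAct b
  iseqv := ⟨fun _ => rfl, fun h => h.symm, fun h h' => h.trans h'⟩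
  mul' {a b c d} h h' := by
    funext s
    rw [stackAct_mul, stackAct_mul, h, h']

/-- It suffices to check the generators: a push followed by the matching pop is the identity, and a
pop of another label always fails. -/
lemma dyckCon_le_stackCon : dyckCon m ≤ stackCon m := by
  refine Con.conGen_le.2 ?_
  rintro _ _ (⟨j⟩ | ⟨i, j, h⟩)
  · funext s
    change [Sum.inl j, Sum.inr j].foldlM stackStep s = some s
    simp [List.foldlM, stackStep]
  · funext s
    change [Sum.inl i, Sum.inr j].foldlM stackStep s = none
    simp [List.foldlM, stackStep, h]

lemma mem_dyckLanguage_of_stackAct {w : List (DyckAlphabet m)} {s t : Stream' (Fin m)}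
    (h : w.foldlM stackStep s = some t) : w ∈ dyckLanguage m := by
  intro h0
  have : stackAct (dyckWord w) s = stackAct 0 s := congrFun (dyckCon_le_stackCon h0) s
  rw [stackAct_dyckWord, h, stackAct_zero] at this
  cases this

/-! ### The bracket-matching map takes values in the Dyck shift -/

/-- The infinite stack of the labels of the brackets that are open at time `n`. -/
noncomputable def openLabels (z : ℤ → Fin 2) (a : ℤ → Fin m) (n : ℤ) : Stream' (Fin m) :=
  fun d => a (onesCount z (sSup {l : ℤ | l < n ∧ height z l ≤ height z n - 1 - d}))

/-- Entry `d` of the stack belongs to the last earlier time at height at most `height z n - 1 - d`.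
A step up adds the present position on top; a step down exposes exactly the label copied by the
closing bracket. -/
lemma stackStep_openLabels (z : ℤ → Fin 2) (a : ℤ → Fin m) (n : ℤ) :
    stackStep (openLabels z a n) (bracketMap m (z, a) n) = some (openLabels z a (n + 1)) := by
  by_cases h : z n = 1
  · have hh := height_succ_of_one h
    simp only [bracketMap, h, if_true, stackStep]
    congr 1
    funext d
    cases d with
    | zero =>
      change a _ = a _
      congr 2
      have h1 : IsGreatest {l : ℤ | l < n + 1 ∧ height z l ≤ height z (n + 1) - 1 - (0 : ℕ)} n :=
        ⟨⟨by omega, by rw [hh]; simp⟩, fun l hl => Int.lt_add_one_iff.1 hl.1⟩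
      exact h1.csSup_eq.symm
    | succ d =>
      change a _ = a _
      congr 3
      ext l
      simp only [Set.mem_ofPred_eq, hh]
      push_cast
      constructor
      · rintro ⟨h1, h2⟩; exact ⟨by omega, by omega⟩
      · rintro ⟨h1, h2⟩
        refine ⟨?_, by omega⟩
        rcases eq_or_ne l n with h3 | h3
        · subst h3; omega
        · omega
  · have hh := height_succ_of_ne h
    simp only [bracketMap, h, if_false, stackStep]
    have h1 : (openLabels z a n).head = a (onesCount z (matchPos z n)) := by
      change a _ = a _
      congr 3
      ext l
      simp only [Set.mem_ofPred_eq, hh]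
      simp
    rw [if_pos h1]
    congr 1
    funext d
    change a _ = a _
    congr 3
    ext l
    simp only [Set.mem_ofPred_eq, hh]
    push_cast
    constructor
    · rintro ⟨h1, h2⟩; exact ⟨by omega, by omega⟩
    · rintro ⟨h1, h2⟩
      refine ⟨?_, by omega⟩
      rcases eq_or_ne l n with h3 | h3
      · subst h3; omega
      · omega

lemma block_eq_map {S : Type*} (x : ℤ → S) (r l : ℤ) :
    block x r l = (List.range (l + 1 - r).toNat).map fun i : ℕ => x (r + i) := by
  simp only [block, List.pure_def, List.bind_eq_flatMap, List.map_flatMap, List.map_cons,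
    List.map_nil]
  exact List.map_eq_flatMap.symm

/-- No balancedness is needed: if a supremum is over the empty set, the stack and the closing
bracket use the same default label. -/
lemma bracketMap_mem_dyckShift (p : (ℤ → Fin 2) × (ℤ → Fin m)) :
    bracketMap m p ∈ dyckShift m := by
  obtain ⟨z, a⟩ := p
  intro r l _
  have key : ∀ k : ℕ, ((List.range k).map fun i : ℕ => bracketMap m (z, a) (r + i)).foldlM stackStep
      (openLabels z a r) = some (openLabels z a (r + k)) := by
    intro k
    induction k with
    | zero => simp
    | succ k ih =>
      rw [List.range_succ, List.map_append, List.foldlM_append, ih]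
      simp [stackStep_openLabels, add_assoc]
  rw [block_eq_map]
  exact mem_dyckLanguage_of_stackAct (key _)

/-! ### Matched brackets in the Dyck shift -/

/-- The pattern of opening (`1`) and closing (`0`) brackets. -/
def bracketType (x : ℤ → DyckAlphabet m) : ℤ → Fin 2 := fun n => if (x n).isLeft then 1 else 0

/-- The label of a bracket. -/
def bracketLabel : DyckAlphabet m → Fin m := Sum.elim id id

lemma bracketType_eq_one_iff {x : ℤ → DyckAlphabet m} {n : ℤ} :
    bracketType x n = 1 ↔ x n = Sum.inl (bracketLabel (x n)) := by
  unfold bracketType bracketLabel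
  cases x n <;> simp

lemma bracketType_ne_one_iff {x : ℤ → DyckAlphabet m} {n : ℤ} :
    bracketType x n ≠ 1 ↔ x n = Sum.inr (bracketLabel (x n)) := by
  unfold bracketType bracketLabel
  cases x n <;> simp

lemma bracketType_bracketMap (p : (ℤ → Fin 2) × (ℤ → Fin m)) :
    bracketType (bracketMap m p) = p.1 := by
  funext n
  by_cases h : p.1 n = 1
  · simp [bracketType, bracketMap, h]
  · simp [bracketType, bracketMap, fin_two_ne_one.1 h]

lemma measurable_bracketType : Measurable (bracketType (m := m)) :=
  measurable_pi_lambda _ fun n => (measurable_of_countable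
    (fun c : DyckAlphabet m => if c.isLeft then (1 : Fin 2) else 0)).comp (measurable_pi_apply n)

lemma measurable_bracketLabel : Measurable (bracketLabel (m := m)) := measurable_of_countable _

lemma dyckWord_append (u v : List (DyckAlphabet m)) :
    dyckWord (u ++ v) = dyckWord u * dyckWord v := by
  simp [dyckWord, FreeMonoid.ofList_append]

/-- A word whose heights stay nonnegative is congruent to zero or to a word of opening brackets. -/
lemma dyckCon_zero_or_opening (x : ℤ → DyckAlphabet m) (r : ℤ) (n : ℕ)
    (h : ∀ i : ℕ, i ≤ n → height (bracketType x) r ≤ height (bracketType x) (r + i)) :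
    dyckCon m (dyckWord ((List.range n).map fun i : ℕ => x (r + i))) 0 ∨
    ∃ s : List (Fin m), dyckCon m (dyckWord ((List.range n).map fun i : ℕ => x (r + i)))
        (dyckWord (s.map Sum.inl)) ∧
      (s.length : ℤ) = height (bracketType x) (r + n) - height (bracketType x) r := by
  induction n with
  | zero => exact Or.inr ⟨[], (dyckCon m).refl _, by simp⟩
  | succ n ih =>
    have e : dyckWord ((List.range (n + 1)).map fun i : ℕ => x (r + i)) =
        dyckWord ((List.range n).map fun i : ℕ => x (r + i)) * dyckWord [x (r + n)] := by
      rw [List.range_succ, List.map_append, dyckWord_append]; rfl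
    have hn := h (n + 1) le_rfl
    rw [e]
    push_cast at hn ⊢
    rw [← add_assoc] at hn ⊢
    rcases ih fun i hi => h i (by omega) with h0 | ⟨s, hs, hlen⟩
    · left
      simpa using (dyckCon m).mul h0 ((dyckCon m).refl (dyckWord [x (r + n)]))
    · have hs' := (dyckCon m).mul hs ((dyckCon m).refl (dyckWord [x (r + n)]))
      by_cases hx : bracketType x (r + n) = 1
      · right
        refine ⟨s ++ [bracketLabel (x (r + n))], ?_, ?_⟩
        · rw [List.map_append, dyckWord_append]
          rw [bracketType_eq_one_iff] at hx
          simp only [List.map_cons, List.map_nil]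
          rwa [← hx]
        · rw [height_succ_of_one hx]
          simp only [List.length_append, List.length_singleton]
          push_cast
          omega
      · rw [height_succ_of_ne hx] at hn ⊢
        replace hx := bracketType_ne_one_iff.1 hx
        -- An empty stack is impossible here, since the closing bracket would take the height below
        -- its initial value.
        rcases List.eq_nil_or_concat s with rfl | ⟨s, i, rfl⟩
        · simp at hlen
          omega
        · rw [hx, List.concat_eq_append, List.map_append, dyckWord_append, mul_assoc,
            ← dyckWord_append] at hs'
          rw [hx]
          simp only [List.concat_eq_append, List.length_append, List.length_singleton] at hlen
          by_cases hi : i = bracketLabel (x (r + n))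
          · right
            refine ⟨s, ?_, by push_cast at hlen; omega⟩
            refine (dyckCon m).trans hs' ?_
            have := (dyckCon m).mul ((dyckCon m).refl (dyckWord (s.map Sum.inl)))
              (ConGen.Rel.of _ _ (DyckRel.cancel i))
            rw [mul_one] at this
            rw [← hi]
            exact this
          · left
            refine (dyckCon m).trans hs' ?_
            have := (dyckCon m).mul ((dyckCon m).refl (dyckWord (s.map Sum.inl)))
              (ConGen.Rel.of _ _ (DyckRel.zero i _ hi))
            rw [mul_zero] at this
            exact this

/-- The positions `p < q` hold an opening bracket and the closing bracket that matches it. -/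
structure Matched (z : ℤ → Fin 2) (p q : ℤ) : Prop where
  lt : p < q
  height_eq : height z (q + 1) = height z p
  lt_height : ∀ j, p < j → j ≤ q → height z p < height z j

lemma Matched.one {z : ℤ → Fin 2} {p q : ℤ} (h : Matched z p q) : z p = 1 :=
  one_of_height_lt (h.lt_height (p + 1) (by omega) (by have := h.lt; omega))

lemma Matched.ne_one {z : ℤ → Fin 2} {p q : ℤ} (h : Matched z p q) : z q ≠ 1 :=
  ne_one_of_height_lt (by rw [h.height_eq]; exact h.lt_height q h.lt le_rfl)

/-- The word strictly between the two brackets is congruent to 0 or to 1, so different labels would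
make the whole block congruent to 0. -/
lemma Matched.bracketLabel_eq {x : ℤ → DyckAlphabet m} (hx : x ∈ dyckShift m) {p q : ℤ}
    (h : Matched (bracketType x) p q) : bracketLabel (x p) = bracketLabel (x q) := by
  have hp := h.one
  have hq := h.ne_one
  have hlt := h.lt
  have hh := height_succ_of_one hp
  obtain ⟨n, rfl⟩ : ∃ n : ℕ, q = p + 1 + n := ⟨(q - (p + 1)).toNat, by omega⟩
  have hhq := height_succ_of_ne hq
  rw [h.height_eq] at hhq
  have hb := hx p (p + 1 + n) (by omega)
  have e : block x p (p + 1 + n) =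
      [x p] ++ ((List.range n).map fun i : ℕ => x (p + 1 + i)) ++ [x (p + 1 + n)] := by
    have e1 : (p + 1 + n + 1 - p).toNat = n + 1 + 1 := by omega
    rw [block_eq_map, e1, List.range_succ, List.map_append, List.range_succ_eq_map]
    simp only [List.map_cons, List.map_map, List.map_nil, List.cons_append, List.nil_append,
      Nat.cast_zero, add_zero, Function.comp_def, Nat.cast_succ]
    simp only [add_assoc, add_comm (1 : ℤ)]
  by_contra hne
  apply hb
  rw [e, dyckWord_append, dyckWord_append]
  rcases dyckCon_zero_or_opening x (p + 1) n (fun i hi => by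
    have := h.lt_height (p + 1 + i) (by omega) (by omega); omega) with h0 | ⟨s, hs, hlen⟩
  · have := (dyckCon m).mul ((dyckCon m).mul ((dyckCon m).refl (dyckWord [x p])) h0)
      ((dyckCon m).refl (dyckWord [x (p + 1 + n)]))
    simpa using this
  · have hs0 : s = [] := List.length_eq_zero_iff.1 (by omega)
    subst hs0
    have := (dyckCon m).mul ((dyckCon m).mul ((dyckCon m).refl (dyckWord [x p])) hs)
      ((dyckCon m).refl (dyckWord [x (p + 1 + n)]))
    refine (dyckCon m).trans this ?_
    rw [← dyckWord_append, ← dyckWord_append]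
    rw [bracketType_eq_one_iff] at hp
    rw [bracketType_ne_one_iff] at hq
    rw [hp, hq]
    exact ConGen.Rel.of _ _ (DyckRel.zero _ _ hne)

/-! ### Measurability of the bracket-matching map -/

lemma bddAbove_matchPos_set (z : ℤ → Fin 2) (n : ℤ) :
    BddAbove {l : ℤ | l < n ∧ height z l ≤ height z (n + 1)} := ⟨n, fun _ hl => hl.1.le⟩

/-- Unfolds the supremum into countably many conditions on heights, for measurability. The second
alternative is the default value of an empty supremum. -/
lemma matchPos_eq_iff (z : ℤ → Fin 2) (n k : ℤ) : matchPos z n = k ↔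
    ((k < n ∧ height z k ≤ height z (n + 1)) ∧
      ∀ l, l < n ∧ height z l ≤ height z (n + 1) → l ≤ k) ∨
    ((∀ l, ¬ (l < n ∧ height z l ≤ height z (n + 1))) ∧ k = 0) := by
  constructor
  · rintro rfl
    by_cases h : {l : ℤ | l < n ∧ height z l ≤ height z (n + 1)}.Nonempty
    · exact Or.inl ⟨Int.csSup_mem h (bddAbove_matchPos_set z n),
        fun l hl => le_csSup (bddAbove_matchPos_set z n) hl⟩
    · refine Or.inr ⟨fun l hl => h ⟨l, hl⟩, ?_⟩
      rw [matchPos, Set.not_nonempty_iff_eq_empty.1 h, Int.csSup_empty]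
  · rintro (⟨h1, h2⟩ | ⟨h1, rfl⟩)
    · exact IsGreatest.csSup_eq (s := {l : ℤ | l < n ∧ height z l ≤ height z (n + 1)})
        ⟨h1, fun l hl => h2 l hl⟩
    · have : {l : ℤ | l < n ∧ height z l ≤ height z (n + 1)} = ∅ :=
        Set.eq_empty_iff_forall_notMem.2 h1
      rw [matchPos, this, Int.csSup_empty]

lemma measurable_matchPos (n : ℤ) : Measurable fun z : ℤ → Fin 2 => matchPos z n := by
  refine measurable_to_countable' fun k => ?_
  have e : (fun z : ℤ → Fin 2 => matchPos z n) ⁻¹' {k} = {z | matchPos z n = k} := rfl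
  rw [e]
  simp only [matchPos_eq_iff]
  have hm := fun l => measurableSet_setOfPred.1
    (measurableSet_le (measurable_height l) (measurable_height (n + 1)))
  have hc : ∀ P : Prop, Measurable fun _ : ℤ → Fin 2 => P := fun P => measurable_const
  refine measurableSet_setOfPred.2 (((((hc _).and (hm k)).and ?_)).or (Measurable.and ?_ (hc _)))
  · exact Measurable.forall fun l => ((hc _).and (hm l)).imp (hc _)
  · exact Measurable.forall fun l => ((hc _).and (hm l)).not

lemma measurable_apply_index {Ω α : Type*} [MeasurableSpace Ω] [MeasurableSpace α]
    {a : Ω → ℤ → α} {i : Ω → ℤ} (ha : Measurable a) (hi : Measurable i) :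
    Measurable fun ω => a ω (i ω) := by
  have h : Measurable fun p : ℤ × (ℤ → α) => p.2 p.1 :=
    measurable_from_prod_countable_right fun i => measurable_pi_apply i
  exact h.comp (hi.prodMk ha)

lemma measurable_bracketMap : Measurable (bracketMap m) := by
  refine measurable_pi_lambda _ fun n => Measurable.ite ?_ ?_ ?_
  · exact ((measurable_pi_apply n).comp measurable_fst) (measurableSet_singleton 1)
  · exact measurable_inl.comp (measurable_apply_index measurable_snd
      ((measurable_onesCount n).comp measurable_fst))
  · refine measurable_inr.comp (measurable_apply_index measurable_snd ?_)
    have := measurable_apply_index (a := fun z : ℤ → Fin 2 => onesCount z)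
      (measurable_pi_lambda _ measurable_onesCount) (measurable_matchPos n)
    exact this.comp measurable_fst

/-! ### The measure -/

lemma dyckMeasure_eq_map (m : ℕ) [NeZero m] :
    dyckMeasure m = ((symmetricProduct 2).prod (symmetricProduct m)).map (bracketMap m) := by
  rw [dyckMeasure, Measure.restrict_eq_self_of_ae_mem]
  filter_upwards [Measure.quasiMeasurePreserving_fst.ae ae_mem_balancedSet] with p hp
  exact ⟨hp, trivial⟩

instance dyckMeasure.instIsProbabilityMeasure (m : ℕ) [NeZero m] :
    IsProbabilityMeasure (dyckMeasure m) := by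
  rw [dyckMeasure_eq_map]
  exact Measure.isProbabilityMeasure_map measurable_bracketMap.aemeasurable

lemma dyckMeasure_dyckShift (m : ℕ) [NeZero m] : dyckMeasure m (dyckShift m) = 1 := by
  refine le_antisymm prob_le_one ?_
  rw [dyckMeasure_eq_map]
  -- This inequality holds for arbitrary sets, so the measurability of the Dyck shift is not needed.
  refine le_trans ?_ (Measure.le_map_apply measurable_bracketMap.aemeasurable _)
  have : bracketMap m ⁻¹' dyckShift m = Set.univ :=
    Set.eq_univ_of_forall bracketMap_mem_dyckShift
  rw [this, measure_univ]

lemma dyckMeasure_apply [NeZero m] {s : Set (ℤ → DyckAlphabet m)} (hs : MeasurableSet s) :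
    dyckMeasure m s =
      ∫⁻ z, symmetricProduct m {a | bracketMap m (z, a) ∈ s} ∂symmetricProduct 2 := by
  rw [dyckMeasure_eq_map, Measure.map_apply measurable_bracketMap hs,
    Measure.prod_apply (measurable_bracketMap hs)]
  rfl

lemma ae_bracketType_mem_balancedSet (m : ℕ) [NeZero m] :
    ∀ᵐ x ∂dyckMeasure m, bracketType x ∈ balancedSet := by
  rw [dyckMeasure_eq_map, ae_map_iff measurable_bracketMap.aemeasurable
    (measurable_bracketType measurableSet_balancedSet)]
  filter_upwards [Measure.quasiMeasurePreserving_fst.ae ae_mem_balancedSet] with p hp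
  rwa [bracketType_bracketMap]

/-! ### Cylinders of the symmetric product measure -/

lemma symmetricProduct_cylinder (k : ℕ) [NeZero k] (J : Finset ℤ) (c : ℤ → Fin k) :
    symmetricProduct k {a | ∀ j ∈ J, a j = c j} = ((k : ENNReal)⁻¹) ^ J.card := by
  have : {a : ℤ → Fin k | ∀ j ∈ J, a j = c j} = Set.pi J fun j => {c j} := by
    ext a; simp [Set.mem_pi]
  rw [this, symmetricProduct, Measure.infinitePi_pi _ fun i _ => measurableSet_singleton _]
  simp only [uniform_toMeasure_singleton, Finset.prod_const]

/-- The probability that the letters read along `p` are the prescribed ones: each index that is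
read counts once, provided that the prescribed letters are consistent. -/
lemma symmetricProduct_reading (k : ℕ) [NeZero k] (W : Finset ℤ) (γ p : ℤ → ℤ) (b : ℤ → Fin k)
    (hγ : Set.InjOn γ (p '' W)) (hb : ∀ i ∈ W, ∀ j ∈ W, p i = p j → b i = b j) :
    symmetricProduct k {a | ∀ n ∈ W, a (γ (p n)) = b n} =
      ((k : ENNReal)⁻¹) ^ (W.image p).card := by
  classical
  have hex : ∃ c : ℤ → Fin k, ∀ n ∈ W, c (γ (p n)) = b n := by
    refine ⟨fun j => if h : ∃ n ∈ W, γ (p n) = j then b h.choose else 0, fun n hn => ?_⟩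
    have h : ∃ n' ∈ W, γ (p n') = γ (p n) := ⟨n, hn, rfl⟩
    simp only [h, dif_pos]
    exact hb _ h.choose_spec.1 _ hn
      (hγ ⟨_, h.choose_spec.1, rfl⟩ ⟨n, hn, rfl⟩ h.choose_spec.2)
  obtain ⟨c, hc⟩ := hex
  have e : {a : ℤ → Fin k | ∀ n ∈ W, a (γ (p n)) = b n} =
      {a | ∀ j ∈ (W.image p).image γ, a j = c j} := by
    ext a
    simp only [Set.mem_ofPred_eq, Finset.mem_image]
    constructor
    · rintro h _ ⟨_, ⟨n, hn, rfl⟩, rfl⟩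
      rw [h n hn, hc n hn]
    · intro h n hn
      rw [h _ ⟨_, ⟨n, hn, rfl⟩, rfl⟩, hc n hn]
  rw [e, symmetricProduct_cylinder, Finset.card_image_of_injOn]
  simpa using hγ

lemma symmetricProduct_reading_eq_zero (k : ℕ) [NeZero k] (W : Finset ℤ) (f : ℤ → ℤ)
    (b : ℤ → Fin k) (hb : ¬ ∀ i ∈ W, ∀ j ∈ W, f i = f j → b i = b j) :
    symmetricProduct k {a | ∀ n ∈ W, a (f n) = b n} = 0 := by
  push Not at hb
  obtain ⟨i, hi, j, hj, hij, hne⟩ := hb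
  have : {a : ℤ → Fin k | ∀ n ∈ W, a (f n) = b n} = ∅ := by
    refine Set.eq_empty_iff_forall_notMem.2 fun a ha => hne ?_
    rw [← ha i hi, ← ha j hj, hij]
  rw [this, measure_empty]

/-! ### Positions of the matching opening brackets -/

lemma Matched.matchPos_eq {z : ℤ → Fin 2} {p n : ℤ} (h : Matched z p n) : matchPos z n = p := by
  rw [matchPos_eq_iff]
  refine Or.inl ⟨⟨h.lt, h.height_eq.ge⟩, fun l hl => ?_⟩
  by_contra! hlp
  have := h.lt_height l hlp hl.1.le
  have := h.height_eq
  omega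

/-- The walk has unit steps, so it cannot rise above the level `height z (n + 1)` without leaving
from that level exactly. -/
lemma matched_matchPos {z : ℤ → Fin 2} {n : ℤ} (hn : z n ≠ 1)
    (hex : ∃ l < n, height z l ≤ height z (n + 1)) : Matched z (matchPos z n) n := by
  obtain ⟨l, hl⟩ := hex
  have hh := height_succ_of_ne hn
  rcases (matchPos_eq_iff z n _).1 rfl with ⟨⟨h1, h2⟩, h3⟩ | ⟨h, -⟩
  · have h4 : ∀ j, matchPos z n < j → j ≤ n → height z (n + 1) < height z j := by
      intro j hj hjn
      rcases hjn.eq_or_lt with rfl | hlt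
      · omega
      · by_contra! h5
        have := h3 j ⟨hlt, h5⟩
        omega
    have h5 := h4 (matchPos z n + 1) (by omega) (by omega)
    have h6 := height_succ_le z (matchPos z n)
    have h7 : height z (n + 1) = height z (matchPos z n) := by omega
    exact ⟨h1, h7, fun j hj hjn => h7 ▸ h4 j hj hjn⟩
  · exact absurd hl (h l)

lemma matched_matchPos_of_mem {z : ℤ → Fin 2} (hz : z ∈ balancedSet) {n : ℤ} (hn : z n ≠ 1) :
    Matched z (matchPos z n) n := by
  obtain ⟨l, hl, hl'⟩ := ((mem_balancedSet_iff z).1 hz).2 (height z (n + 1)) (n - 1)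
  exact matched_matchPos hn ⟨l, by omega, hl'⟩

/-- The position of the opening bracket that carries the label read at `n`. -/
noncomputable def openPos (z : ℤ → Fin 2) (n : ℤ) : ℤ := if z n = 1 then n else matchPos z n

lemma openPos_of_one {z : ℤ → Fin 2} {n : ℤ} (h : z n = 1) : openPos z n = n := if_pos h

lemma openPos_of_ne {z : ℤ → Fin 2} {n : ℤ} (h : z n ≠ 1) : openPos z n = matchPos z n := if_neg h

lemma bracketLabel_bracketMap (z : ℤ → Fin 2) (a : ℤ → Fin m) (n : ℤ) :
    bracketLabel (bracketMap m (z, a) n) = a (onesCount z (openPos z n)) := by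
  by_cases h : z n = 1
  · simp [bracketMap, openPos, h, bracketLabel]
  · simp [bracketMap, openPos, fin_two_ne_one.1 h, bracketLabel]

lemma eq_iff_bracketType_bracketLabel (x y : ℤ → DyckAlphabet m) (n : ℤ) :
    x n = y n ↔ bracketType x n = bracketType y n ∧ bracketLabel (x n) = bracketLabel (y n) := by
  unfold bracketType bracketLabel
  cases x n <;> cases y n <;> simp

lemma onesCount_openPos_injOn {z : ℤ → Fin 2} (hz : z ∈ balancedSet) (W : Set ℤ) :
    Set.InjOn (onesCount z) (openPos z '' W) := by
  refine (onesCount_injOn z).mono ?_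
  rintro _ ⟨n, -, rfl⟩
  by_cases h : z n = 1
  · rwa [openPos_of_one h]
  · rw [openPos_of_ne h]
    exact (matched_matchPos_of_mem hz h).one

/-! ### Excursions -/

/-- The height makes an excursion on `[r, l]`: it ends where it starts and does not go below. -/
structure Excursion (z : ℤ → Fin 2) (r l : ℤ) : Prop where
  le : r ≤ l
  height_eq : height z l = height z r
  le_height : ∀ j, r ≤ j → j ≤ l → height z r ≤ height z j

lemma Excursion.congr {z z' : ℤ → Fin 2} {r l : ℤ} (h : Excursion z r l)
    (hz : ∀ j ∈ Finset.Ico r l, z j = z' j) : Excursion z' r l := by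
  have key : ∀ j, r ≤ j → j ≤ l → height z j - height z r = height z' j - height z' r :=
    fun j h1 h2 => height_sub_congr h1 fun i h3 h4 => hz i (by rw [Finset.mem_Ico]; omega)
  refine ⟨h.le, ?_, fun j h1 h2 => ?_⟩
  · have := key l h.le le_rfl
    have := h.height_eq
    omega
  · have := key j h1 h2
    have := h.le_height j h1 h2
    omega

/-- The left end `r` is itself a candidate in the supremum, because the height does not go below its
value there; hence the partner lies at or after `r`. -/
lemma Excursion.matched_matchPos {z : ℤ → Fin 2} {r l n : ℤ} (h : Excursion z r l)
    (hn : n ∈ Finset.Ico r l) (hz : z n ≠ 1) :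
    Matched z (matchPos z n) n ∧ matchPos z n ∈ Finset.Ico r l := by
  rw [Finset.mem_Ico] at hn ⊢
  have h1 := h.le_height (n + 1) (by omega) (by omega)
  have h2 := height_succ_of_ne hz
  have hne : r ≠ n := by rintro rfl; omega
  have hm := _root_.matched_matchPos hz ⟨r, by omega, h1⟩
  refine ⟨hm, ?_, by have := hm.lt; omega⟩
  exact le_csSup (bddAbove_matchPos_set z n) ⟨by omega, h1⟩

lemma Excursion.openPos_mem {z : ℤ → Fin 2} {r l n : ℤ} (h : Excursion z r l)
    (hn : n ∈ Finset.Ico r l) : openPos z n ∈ Finset.Ico r l ∧ z (openPos z n) = 1 := by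
  by_cases hz : z n = 1
  · rw [openPos_of_one hz]; exact ⟨hn, hz⟩
  · rw [openPos_of_ne hz]
    have := h.matched_matchPos hn hz
    exact ⟨this.2, this.1.one⟩

/-- A partner outside would force the height to stay above that of `p` up to the end `l`, where it
has returned to the minimum of the excursion. -/
lemma Matched.notMem_of_excursion {z : ℤ → Fin 2} {r l p n : ℤ} (h : Excursion z r l)
    (hn : n ∉ Finset.Ico r l) (hm : Matched z p n) : p ∉ Finset.Ico r l := by
  rw [Finset.mem_Ico] at hn ⊢
  rintro ⟨h1, h2⟩
  have := hm.lt
  have h3 := hm.lt_height l h2 (by omega)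
  have h4 := h.le_height p h1 h2.le
  have := h.height_eq
  omega

/-- Brackets matched outside of an excursion stay matched if it is replaced by another one. -/
lemma Matched.congr_excursion {z z' : ℤ → Fin 2} {r l p n : ℤ} (h : Excursion z r l)
    (h' : Excursion z' r l) (hzz : ∀ j ∉ Finset.Ico r l, z j = z' j)
    (hn : n ∉ Finset.Ico r l) (hm : Matched z p n) : Matched z' p n := by
  have hp := hm.notMem_of_excursion h hn
  simp only [Finset.mem_Ico] at hn hp hzz
  have hlt := hm.lt
  have hle := h.le
  have e1 := h.height_eq
  have e2 := h'.height_eq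
  -- Nothing is known about the symbols inside `[r, l)`, but both excursions have net height zero
  -- there, so a passage across the whole interval contributes equally.
  have key : ∀ j, p ≤ j → j ≤ n + 1 → (j ≤ r ∨ l ≤ j) →
      height z' j - height z' p = height z j - height z p := by
    intro j hpj hjn hj
    by_cases hc : p < r ∧ l ≤ j
    · have h1 := height_sub_congr (z := z) (z' := z') hc.1.le
        fun i h3 h4 => hzz i (by omega)
      have h2 := height_sub_congr (z := z) (z' := z') hc.2
        fun i h3 h4 => hzz i (by omega)
      omega
    · exact (height_sub_congr hpj fun i h3 h4 => hzz i (by omega)).symm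
  refine ⟨hlt, ?_, fun j h1 h2 => ?_⟩
  · have := key (n + 1) (by omega) le_rfl (by omega)
    have := hm.height_eq
    omega
  · by_cases hj : j ≤ r ∨ l ≤ j
    · have := key j h1.le (by omega) hj
      have := hm.lt_height j h1 h2
      omega
    · have h3 := key r (by omega) (by omega) (by omega)
      have h4 := hm.lt_height r (by omega) (by omega)
      have h5 := h'.le_height j (by omega) (by omega)
      omega

lemma openPos_notMem {z : ℤ → Fin 2} (hz : z ∈ balancedSet) {r l n : ℤ} (h : Excursion z r l)
    (hn : n ∉ Finset.Ico r l) : openPos z n ∉ Finset.Ico r l := by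
  by_cases h1 : z n = 1
  · rwa [openPos_of_one h1]
  · rw [openPos_of_ne h1]
    exact (matched_matchPos_of_mem hz h1).notMem_of_excursion h hn

lemma openPos_congr_excursion {z z' : ℤ → Fin 2} (hz : z ∈ balancedSet) {r l n : ℤ}
    (h : Excursion z r l) (h' : Excursion z' r l) (hzz : ∀ j ∉ Finset.Ico r l, z j = z' j)
    (hn : n ∉ Finset.Ico r l) : openPos z' n = openPos z n := by
  by_cases h1 : z n = 1
  · rw [openPos_of_one h1, openPos_of_one (by rwa [← hzz n hn])]
  · rw [openPos_of_ne h1, openPos_of_ne (by rwa [← hzz n hn])]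
    exact ((matched_matchPos_of_mem hz h1).congr_excursion h h' hzz hn).matchPos_eq

lemma height_sub_eq_card (z : ℤ → Fin 2) {p q : ℤ} (hpq : p ≤ q) :
    height z q - height z p = 2 * ((Finset.Ico p q).filter fun j => z j = 1).card - (q - p) := by
  induction q, hpq using Int.leInduction with
  | base => simp
  | succ q hq ih =>
    have e : Finset.Ico p (q + 1) = insert q (Finset.Ico p q) := by
      ext j
      simp only [Finset.mem_Ico, Finset.mem_insert]
      omega
    rw [e, Finset.filter_insert, height_succ]
    split_ifs with h
    · rw [Finset.card_insert_of_notMem (by simp)]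
      push_cast
      omega
    · omega

/-- The labels read inside are those of the opening brackets inside, and these are half of the
positions. Only the length of the excursion enters. -/
lemma Excursion.two_mul_card_image_openPos {z : ℤ → Fin 2} {r l : ℤ} (h : Excursion z r l) :
    (2 * ((Finset.Ico r l).image (openPos z)).card : ℤ) = l - r := by
  have e : (Finset.Ico r l).image (openPos z) = (Finset.Ico r l).filter fun j => z j = 1 := by
    ext j
    simp only [Finset.mem_image, Finset.mem_filter]
    constructor
    · rintro ⟨n, hn, rfl⟩
      exact h.openPos_mem hn
    · rintro ⟨h1, h2⟩
      exact ⟨j, h1, openPos_of_one h2⟩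
  rw [e]
  have := height_sub_eq_card z h.le
  have := h.height_eq
  omega

lemma Excursion.bracketLabel_openPos {x : ℤ → DyckAlphabet m} (hx : x ∈ dyckShift m) {r l n : ℤ}
    (h : Excursion (bracketType x) r l) (hn : n ∈ Finset.Ico r l) :
    bracketLabel (x (openPos (bracketType x) n)) = bracketLabel (x n) := by
  by_cases hz : bracketType x n = 1
  · rw [openPos_of_one hz]
  · rw [openPos_of_ne hz]
    exact (h.matched_matchPos hn hz).1.bracketLabel_eq hx

lemma Excursion.openPos_congr {z z' : ℤ → Fin 2} {r l n : ℤ} (h : Excursion z r l)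
    (hzz : ∀ j ∈ Finset.Ico r l, z j = z' j) (hn : n ∈ Finset.Ico r l) :
    openPos z' n = openPos z n := by
  by_cases hz : z n = 1
  · rw [openPos_of_one hz, openPos_of_one (by rwa [← hzz n hn])]
  · rw [openPos_of_ne hz, openPos_of_ne (by rwa [← hzz n hn])]
    obtain ⟨hm, hmem⟩ := h.matched_matchPos hn hz
    rw [Finset.mem_Ico] at hn hmem
    have hlt := hm.lt
    have key : ∀ j, matchPos z n ≤ j → j ≤ n + 1 →
        height z j - height z (matchPos z n) = height z' j - height z' (matchPos z n) :=
      fun j h1 h2 => height_sub_congr h1 fun i h3 h4 => hzz i (by rw [Finset.mem_Ico]; omega)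
    have hm' : Matched z' (matchPos z n) n := by
      refine ⟨hm.lt, ?_, fun j h1 h2 => ?_⟩
      · have := key (n + 1) (by omega) le_rfl
        have := hm.height_eq
        omega
      · have := key j h1.le (by omega)
        have := hm.lt_height j h1 h2
        omega
    exact hm'.matchPos_eq

/-! ### Exchanging excursions -/

/-- Inside and outside positions never share a label, and outside the matching and the prescribed
letters are unchanged. -/
lemma consistent_of_excursion {k : ℕ} {z z' : ℤ → Fin 2} (hz : z ∈ balancedSet)
    (hz' : z' ∈ balancedSet) {r l : ℤ} (h : Excursion z r l) (h' : Excursion z' r l)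
    (hzz : ∀ j ∉ Finset.Ico r l, z j = z' j) {b b' : ℤ → Fin k}
    (hbb : ∀ j ∉ Finset.Ico r l, b j = b' j)
    (hb' : ∀ i ∈ Finset.Ico r l, ∀ j ∈ Finset.Ico r l, openPos z' i = openPos z' j → b' i = b' j)
    {W : Finset ℤ} (hc : ∀ i ∈ W, ∀ j ∈ W, openPos z i = openPos z j → b i = b j) :
    ∀ i ∈ W, ∀ j ∈ W, openPos z' i = openPos z' j → b' i = b' j := by
  intro i hi j hj hij
  by_cases h1 : i ∈ Finset.Ico r l <;> by_cases h2 : j ∈ Finset.Ico r l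
  · exact hb' i h1 j h2 hij
  · exact absurd (hij ▸ (h'.openPos_mem h1).1) (openPos_notMem hz' h' h2)
  · exact absurd (hij.symm ▸ (h'.openPos_mem h2).1) (openPos_notMem hz' h' h1)
  · rw [← hbb i h1, ← hbb j h2]
    refine hc i hi j hj ?_
    rwa [openPos_congr_excursion hz h h' hzz h1, openPos_congr_excursion hz h h' hzz h2] at hij

lemma card_image_openPos {z : ℤ → Fin 2} (hz : z ∈ balancedSet) {r l : ℤ} (h : Excursion z r l)
    {W : Finset ℤ} (hW : Finset.Ico r l ⊆ W) :
    (W.image (openPos z)).card = ((Finset.Ico r l).image (openPos z)).card +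
      ((W \ Finset.Ico r l).image (openPos z)).card := by
  rw [← Finset.card_union_of_disjoint, ← Finset.image_union, Finset.union_sdiff_of_subset hW]
  rw [Finset.disjoint_left]
  intro p hp hp'
  obtain ⟨i, hi, rfl⟩ := Finset.mem_image.1 hp
  obtain ⟨j, hj, hij⟩ := Finset.mem_image.1 hp'
  exact openPos_notMem hz h (Finset.mem_sdiff.1 hj).2 (hij ▸ (h.openPos_mem hi).1)

/-- Both prescriptions are consistent or neither is. In the first case equally many independent
labels are read; in the second both events are empty. -/
lemma symmetricProduct_reading_excursion {k : ℕ} [NeZero k] {z z' : ℤ → Fin 2}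
    (hz : z ∈ balancedSet) (hz' : z' ∈ balancedSet) {r l : ℤ} (h : Excursion z r l)
    (h' : Excursion z' r l) (hzz : ∀ j ∉ Finset.Ico r l, z j = z' j) {b b' : ℤ → Fin k}
    (hbb : ∀ j ∉ Finset.Ico r l, b j = b' j)
    (hb : ∀ i ∈ Finset.Ico r l, ∀ j ∈ Finset.Ico r l, openPos z i = openPos z j → b i = b j)
    (hb' : ∀ i ∈ Finset.Ico r l, ∀ j ∈ Finset.Ico r l, openPos z' i = openPos z' j → b' i = b' j)
    {W : Finset ℤ} (hW : Finset.Ico r l ⊆ W) :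
    symmetricProduct k {a | ∀ n ∈ W, a (onesCount z (openPos z n)) = b n} =
    symmetricProduct k {a | ∀ n ∈ W, a (onesCount z' (openPos z' n)) = b' n} := by
  by_cases hc : ∀ i ∈ W, ∀ j ∈ W, openPos z i = openPos z j → b i = b j
  · have hc' := consistent_of_excursion hz hz' h h' hzz hbb hb' hc
    rw [symmetricProduct_reading k W _ _ b (onesCount_openPos_injOn hz _) hc,
      symmetricProduct_reading k W _ _ b' (onesCount_openPos_injOn hz' _) hc',
      card_image_openPos hz h hW, card_image_openPos hz' h' hW]
    have e1 := h.two_mul_card_image_openPos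
    have e2 := h'.two_mul_card_image_openPos
    have e3 : (W \ Finset.Ico r l).image (openPos z) = (W \ Finset.Ico r l).image (openPos z') :=
      Finset.image_congr fun n hn =>
        (openPos_congr_excursion hz h h' hzz (Finset.mem_sdiff.1 hn).2).symm
    rw [e3]
    congr 2
    omega
  · have hc' : ¬ ∀ i ∈ W, ∀ j ∈ W, openPos z' i = openPos z' j → b' i = b' j := fun H =>
      hc (consistent_of_excursion hz' hz h' h (fun j hj => (hzz j hj).symm)
        (fun j hj => (hbb j hj).symm) hb H)
    rw [symmetricProduct_reading_eq_zero, symmetricProduct_reading_eq_zero]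
    · intro H
      exact hc' fun i hi j hj hij => H i hi j hj (congrArg _ hij)
    · intro H
      exact hc fun i hi j hj hij => H i hi j hj (congrArg _ hij)

lemma measurePreserving_add_symmetricProduct (k : ℕ) [NeZero k] (d : ℤ → Fin k) :
    MeasurePreserving (fun z => z + d) (symmetricProduct k) (symmetricProduct k) := by
  refine ⟨measurable_pi_lambda _ fun n => (measurable_of_countable (fun c : Fin k => c + d n)).comp
    (measurable_pi_apply n), ?_⟩
  have h := Measure.infinitePi_map_pi (fun _ : ℤ => (PMF.uniformOfFintype (Fin k)).toMeasure)
    (f := fun n c => c + d n) (fun n => measurable_of_countable _)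
  have e : ∀ n, (PMF.uniformOfFintype (Fin k)).toMeasure.map (fun c => c + d n) =
      (PMF.uniformOfFintype (Fin k)).toMeasure := by
    intro n
    refine Measure.ext_of_singleton fun c => ?_
    rw [Measure.map_apply (measurable_of_countable _) (measurableSet_singleton c)]
    have : (fun c => c + d n) ⁻¹' {c} = {c - d n} := by
      ext c'
      rw [Set.mem_preimage, Set.mem_singleton_iff, Set.mem_singleton_iff, eq_sub_iff_add_eq]
    rw [this, uniform_toMeasure_singleton, uniform_toMeasure_singleton]
  simp only [e] at h
  exact h

lemma bracketMap_eq_on_iff (z : ℤ → Fin 2) (u : ℤ → DyckAlphabet m) (W : Finset ℤ)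
    (a : ℤ → Fin m) : (∀ n ∈ W, bracketMap m (z, a) n = u n) ↔
      (∀ n ∈ W, z n = bracketType u n) ∧
        ∀ n ∈ W, a (onesCount z (openPos z n)) = bracketLabel (u n) := by
  simp only [eq_iff_bracketType_bracketLabel (bracketMap m (z, a)) u, bracketType_bracketMap,
    bracketLabel_bracketMap]
  exact forall₂_and

lemma measurableSet_eq_on (W : Finset ℤ) (u : ℤ → DyckAlphabet m) :
    MeasurableSet {t : ℤ → DyckAlphabet m | ∀ n ∈ W, t n = u n} := by
  have : {t : ℤ → DyckAlphabet m | ∀ n ∈ W, t n = u n} = Set.pi W fun n => {u n} := by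
    ext t; simp [Set.mem_pi]
  rw [this]
  exact MeasurableSet.pi W.countable_toSet fun n _ => measurableSet_singleton _

/-- Two words over the same window that contain different excursions of points of the Dyck shift,
but agree otherwise, are equally likely. -/
lemma dyckMeasure_exchange [NeZero m] {x y : ℤ → DyckAlphabet m} (hx : x ∈ dyckShift m)
    (hy : y ∈ dyckShift m) {r l : ℤ} (h : Excursion (bracketType x) r l)
    (h' : Excursion (bracketType y) r l) {u v : ℤ → DyckAlphabet m} {W : Finset ℤ}
    (hW : Finset.Ico r l ⊆ W) (hu : ∀ n ∈ Finset.Ico r l, u n = x n)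
    (hv : ∀ n ∈ Finset.Ico r l, v n = y n) (huv : ∀ n ∉ Finset.Ico r l, u n = v n) :
    dyckMeasure m {t | ∀ n ∈ W, t n = u n} = dyckMeasure m {t | ∀ n ∈ W, t n = v n} := by
  have htype : ∀ {u v : ℤ → DyckAlphabet m} {n : ℤ}, u n = v n →
      bracketType u n = bracketType v n := fun h => by simp only [bracketType, h]
  have cons : ∀ {x u : ℤ → DyckAlphabet m} {z : ℤ → Fin 2}, x ∈ dyckShift m →
      Excursion (bracketType x) r l → (∀ n ∈ Finset.Ico r l, u n = x n) →
      (∀ n ∈ W, z n = bracketType u n) → Excursion z r l ∧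
      ∀ i ∈ Finset.Ico r l, ∀ j ∈ Finset.Ico r l, openPos z i = openPos z j →
        bracketLabel (u i) = bracketLabel (u j) := by
    intro x u z hx h hu hz
    have e : ∀ j ∈ Finset.Ico r l, bracketType x j = z j := fun j hj => by
      rw [hz j (hW hj), htype (hu j hj)]
    refine ⟨h.congr e, fun i hi j hj hij => ?_⟩
    rw [h.openPos_congr e hi, h.openPos_congr e hj] at hij
    rw [hu i hi, hu j hj, ← h.bracketLabel_openPos hx hi, ← h.bracketLabel_openPos hx hj, hij]
  rw [dyckMeasure_apply (measurableSet_eq_on W u), dyckMeasure_apply (measurableSet_eq_on W v)]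
  -- Translation by `d` modulo 2 preserves the fair coin measure and carries the type pattern of `u`
  -- to that of `v`, so the label probabilities can be compared pointwise.
  let d : ℤ → Fin 2 := bracketType v - bracketType u
  have hmp := measurePreserving_add_symmetricProduct 2 d
  have hmeas : Measurable fun z => symmetricProduct m
      {a | bracketMap m (z, a) ∈ {t : ℤ → DyckAlphabet m | ∀ n ∈ W, t n = v n}} :=
    measurable_measure_prodMk_left (measurable_bracketMap (measurableSet_eq_on W v))
  rw [← hmp.lintegral_comp hmeas]
  refine lintegral_congr_ae ?_
  filter_upwards [ae_mem_balancedSet, hmp.quasiMeasurePreserving.ae ae_mem_balancedSet]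
    with z hz hz'
  simp only [bracketMap_eq_on_iff]
  have hd : ∀ n, (z + d) n = bracketType v n ↔ z n = bracketType u n := fun n => by
    simp only [d, Pi.add_apply, Pi.sub_apply]
    constructor
    · intro H
      have : z n = bracketType v n - (bracketType v n - bracketType u n) := by
        rw [eq_sub_iff_add_eq]; exact H
      simpa using this
    · intro H
      rw [H]; simp
  have hzz : ∀ j ∉ Finset.Ico r l, z j = (z + d) j := fun j hj => by
    simp [d, htype (huv j hj)]
  by_cases H : ∀ n ∈ W, z n = bracketType u n
  · have H' : ∀ n ∈ W, (z + d) n = bracketType v n := fun n hn => (hd n).2 (H n hn)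
    simp only [eq_true H, eq_true H', true_and]
    obtain ⟨c1, c2⟩ := cons hx h hu H
    obtain ⟨c3, c4⟩ := cons hy h' hv H'
    exact symmetricProduct_reading_excursion hz hz' c1 c3 hzz
      (fun j hj => by rw [huv j hj]) c2 c4 hW
  · have H' : ¬ ∀ n ∈ W, (z + d) n = bracketType v n := fun H' =>
      H fun n hn => (hd n).1 (H' n hn)
    simp only [eq_false H, eq_false H', false_and]

/-! ### Exchanging excursions in Borel sets -/

/-- A finite measure on sequences over a countable alphabet is determined by its values on
cylinders. -/
lemma measure_ext_of_cylinders {S : Type*} [MeasurableSpace S] [MeasurableSingletonClass S]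
    [Countable S] [Nonempty S] {μ ν : Measure (ℤ → S)} [IsFiniteMeasure μ]
    (h : ∀ (I : Finset ℤ) (w : ℤ → S), μ {t | ∀ n ∈ I, t n = w n} = ν {t | ∀ n ∈ I, t n = w n}) :
    μ = ν := by
  classical
  have : ∀ I : Finset ℤ, IsFiniteMeasure (μ.map I.restrict) := fun I => inferInstance
  refine IsProjectiveLimit.unique (P := fun I : Finset ℤ => μ.map I.restrict) (fun _ => rfl)
    fun I => Measure.ext_of_singleton fun c => ?_
  obtain ⟨s⟩ := ‹Nonempty S›
  have e : (I.restrict : (ℤ → S) → I → S) ⁻¹' {c} =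
      {t : ℤ → S | ∀ n ∈ I, t n = if hn : n ∈ I then c ⟨n, hn⟩ else s} := by
    ext t
    simp only [Set.mem_preimage, Set.mem_singleton_iff, Set.mem_ofPred_eq]
    constructor
    · rintro rfl n hn
      simp [hn]
    · intro H
      funext ⟨n, hn⟩
      have := H n hn
      simpa [hn] using this
  rw [Measure.map_apply (Finset.measurable_restrict I) (measurableSet_singleton c),
    Measure.map_apply (Finset.measurable_restrict I) (measurableSet_singleton c), e, h]

lemma measurable_piecewise_const {S : Type*} [MeasurableSpace S] (K : Finset ℤ) (x : ℤ → S) :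
    Measurable fun t : ℤ → S => K.piecewise x t := by
  refine measurable_pi_lambda _ fun n => ?_
  by_cases hn : n ∈ K
  · simp [hn]
  · simpa [hn] using measurable_pi_apply n

lemma piecewise_image_eq {S : Type*} {K : Finset ℤ} {x y : ℤ → S} {B : Set (ℤ → S)}
    (hB : ∀ t ∈ B, ∀ n ∈ K, t n = x n) :
    (fun t => K.piecewise y t) '' B =
      (fun t => K.piecewise x t) ⁻¹' B ∩ {t | ∀ n ∈ K, t n = y n} := by
  ext s
  constructor
  · rintro ⟨t, ht, rfl⟩
    refine ⟨?_, fun n hn => by simp [hn]⟩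
    have : K.piecewise x (K.piecewise y t) = t := by
      funext n
      by_cases hn : n ∈ K
      · simp [hn, hB t ht n hn]
      · simp [hn]
    simpa only [Set.mem_preimage, this] using ht
  · rintro ⟨h1, h2⟩
    refine ⟨_, h1, ?_⟩
    funext n
    by_cases hn : n ∈ K
    · simp [hn, h2 n hn]
    · simp [hn]

lemma dyckMeasure_image_exchange [NeZero m] {x y : ℤ → DyckAlphabet m} (hx : x ∈ dyckShift m)
    (hy : y ∈ dyckShift m) {r l : ℤ} (h : Excursion (bracketType x) r l)
    (h' : Excursion (bracketType y) r l) {B : Set (ℤ → DyckAlphabet m)} (hB : MeasurableSet B)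
    (hBx : ∀ t ∈ B, ∀ n ∈ Finset.Ico r l, t n = x n) :
    MeasurableSet ((fun t => (Finset.Ico r l).piecewise y t) '' B) ∧
    dyckMeasure m ((fun t => (Finset.Ico r l).piecewise y t) '' B) = dyckMeasure m B := by
  set K := Finset.Ico r l with hK
  have hT := measurable_piecewise_const K x
  rw [piecewise_image_eq hBx]
  refine ⟨(hT hB).inter (measurableSet_eq_on K y), ?_⟩
  -- Writing `x` on `K` carries the measure on the cylinder of `y` to that on the cylinder of `x`.
  -- Comparison on cylinders is enough, and there it is `dyckMeasure_exchange`.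
  have key : (dyckMeasure m).restrict {t | ∀ n ∈ K, t n = x n} =
      ((dyckMeasure m).restrict {t | ∀ n ∈ K, t n = y n}).map fun t => K.piecewise x t := by
    have : Nonempty (DyckAlphabet m) := ⟨x 0⟩
    refine measure_ext_of_cylinders fun I w => ?_
    have hI := measurableSet_eq_on I w
    rw [Measure.map_apply hT hI, Measure.restrict_apply hI, Measure.restrict_apply (hT hI)]
    by_cases hw : ∀ n ∈ I, n ∈ K → w n = x n
    · have e1 : {t : ℤ → DyckAlphabet m | ∀ n ∈ I, t n = w n} ∩ {t | ∀ n ∈ K, t n = x n} =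
          {t | ∀ n ∈ I ∪ K, t n = K.piecewise x w n} := by
        ext t
        simp only [Set.mem_inter_iff, Set.mem_ofPred_eq, Finset.mem_union]
        constructor
        · rintro ⟨h1, h2⟩ n hn
          by_cases hnK : n ∈ K
          · simp [hnK, h2 n hnK]
          · simp [hnK, h1 n (hn.resolve_right hnK)]
        · intro H
          refine ⟨fun n hn => ?_, fun n hn => by simpa [hn] using H n (Or.inr hn)⟩
          have := H n (Or.inl hn)
          by_cases hnK : n ∈ K
          · simpa [hnK, hw n hn hnK] using this
          · simpa [hnK] using this
      have e2 : (fun t => K.piecewise x t) ⁻¹' {t : ℤ → DyckAlphabet m | ∀ n ∈ I, t n = w n} ∩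
          {t | ∀ n ∈ K, t n = y n} = {t | ∀ n ∈ I ∪ K, t n = K.piecewise y w n} := by
        ext t
        simp only [Set.mem_inter_iff, Set.mem_preimage, Set.mem_ofPred_eq, Finset.mem_union]
        constructor
        · rintro ⟨h1, h2⟩ n hn
          by_cases hnK : n ∈ K
          · simp [hnK, h2 n hnK]
          · simpa [hnK] using h1 n (hn.resolve_right hnK)
        · intro H
          refine ⟨fun n hn => ?_, fun n hn => by simpa [hn] using H n (Or.inr hn)⟩
          have := H n (Or.inl hn)
          by_cases hnK : n ∈ K
          · simp [hnK, hw n hn hnK]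
          · simpa [hnK] using this
      rw [e1, e2]
      refine dyckMeasure_exchange hx hy h h' Finset.subset_union_right (fun n hn => ?_)
        (fun n hn => ?_) fun n hn => ?_
      · exact Finset.piecewise_eq_of_mem _ _ _ hn
      · exact Finset.piecewise_eq_of_mem _ _ _ hn
      · rw [← hK] at hn
        simp [hn]
    -- If `w` conflicts with `x` on `K`, both sets are empty.
    · push Not at hw
      obtain ⟨n, hn, hnK, hne⟩ := hw
      have e1 : {t : ℤ → DyckAlphabet m | ∀ n ∈ I, t n = w n} ∩ {t | ∀ n ∈ K, t n = x n} = ∅ :=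
        Set.eq_empty_iff_forall_notMem.2 fun t ht => hne (by rw [← ht.1 n hn, ← ht.2 n hnK])
      have e2 : (fun t => K.piecewise x t) ⁻¹' {t : ℤ → DyckAlphabet m | ∀ n ∈ I, t n = w n} ∩
          {t | ∀ n ∈ K, t n = y n} = ∅ :=
        Set.eq_empty_iff_forall_notMem.2 fun t ht => hne (by simpa [hnK] using (ht.1 n hn).symm)
      rw [e1, e2]
  have e := congrArg (fun ν => ν B) key
  rw [Measure.map_apply hT hB, Measure.restrict_apply hB, Measure.restrict_apply (hT hB)] at e
  rw [← e]
  congr 1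
  exact Set.inter_eq_left.2 fun t ht => hBx t ht

/-! ### Last and first passages -/

lemma exists_last_passage {z : ℤ → Fin 2} (hz : z ∈ balancedSet) {N h : ℤ} (hN : h < height z N) :
    ∃ p < N, height z p = h ∧ ∀ j, p < j → j ≤ N → h < height z j := by
  obtain ⟨p, ⟨hp1, hp2⟩, hp3⟩ := Int.exists_greatest_of_bdd
    (P := fun p => p ≤ N ∧ height z p ≤ h) ⟨N, fun _ hp => hp.1⟩
    (((mem_balancedSet_iff z).1 hz).2 h N)
  have hne : p ≠ N := by rintro rfl; omega
  have h1 : ∀ j, p < j → j ≤ N → h < height z j := fun j hj hjN => by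
    by_contra! H
    have := hp3 j ⟨hjN, H⟩
    omega
  have h2 := h1 (p + 1) (by omega) (by omega)
  have h3 := height_succ_le z p
  exact ⟨p, by omega, by omega, h1⟩

lemma exists_first_passage {z : ℤ → Fin 2} (hz : z ∈ balancedSet) {N h : ℤ} (hN : h < height z N) :
    ∃ q ≥ N, height z (q + 1) = h ∧ ∀ j, N ≤ j → j ≤ q → h < height z j := by
  obtain ⟨q, ⟨hq1, hq2⟩, hq3⟩ := Int.exists_least_of_bdd
    (P := fun q => N ≤ q ∧ height z q ≤ h) ⟨N, fun _ hq => hq.1⟩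
    (((mem_balancedSet_iff z).1 hz).1 h N)
  have hne : q ≠ N := by rintro rfl; omega
  have h1 : ∀ j, N ≤ j → j < q → h < height z j := fun j hj hjN => by
    by_contra! H
    have := hq3 j ⟨hj, H⟩
    omega
  have h2 := h1 (q - 1) (by omega) (by omega)
  have h3 := height_le_succ_add z (q - 1)
  rw [sub_add_cancel] at h3
  exact ⟨q - 1, by omega, by rw [sub_add_cancel]; omega, fun j hj hjq => h1 j hj (by omega)⟩

/-- The last time before the origin at which the height is `h`. -/
structure LastPassage (z : ℤ → Fin 2) (h p : ℤ) : Prop where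
  neg : p < 0
  height_eq : height z p = h
  lt_height : ∀ j, p < j → j ≤ 0 → h < height z j

lemma LastPassage.one {z : ℤ → Fin 2} {h p : ℤ} (hp : LastPassage z h p) : z p = 1 := by
  refine one_of_height_lt ?_
  rw [hp.height_eq]
  exact hp.lt_height _ (by omega) (by have := hp.neg; omega)

lemma LastPassage.unique {z : ℤ → Fin 2} {h p q : ℤ} (hp : LastPassage z h p)
    (hq : LastPassage z h q) : p = q := by
  have h1 := hp.height_eq
  have h2 := hq.height_eq
  rcases lt_trichotomy p q with h3 | h3 | h3
  · have := hp.lt_height q h3 hq.neg.le; omega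
  · exact h3
  · have := hq.lt_height p h3 hp.neg.le; omega

lemma measurableSet_lastPassage (h p : ℤ) : MeasurableSet {z : ℤ → Fin 2 | LastPassage z h p} := by
  have e : {z : ℤ → Fin 2 | LastPassage z h p} = {z | p < 0 ∧ height z p = h ∧
      ∀ j, p < j → j ≤ 0 → h < height z j} :=
    Set.ext fun z => ⟨fun H => ⟨H.1, H.2, H.3⟩, fun H => ⟨H.1, H.2.1, H.2.2⟩⟩
  rw [e]
  refine measurableSet_setOfPred.2 (measurable_const.and (Measurable.and ?_ ?_))
  · exact measurableSet_setOfPred.1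
      (measurableSet_eq_fun (measurable_height p) (measurable_const (a := h)))
  · exact Measurable.forall fun j => measurable_const.imp (measurable_const.imp
      (measurableSet_setOfPred.1 (measurableSet_lt (measurable_const (a := h))
        (measurable_height j))))

/-! ### Points with an eventually periodic stack of open brackets -/

/-- The points for which the labels of the brackets that are open at the origin are eventually
periodic. -/
def periodicStackSet (m : ℕ) : Set (ℤ → DyckAlphabet m) :=
  {x | ∃ d : ℕ, 0 < d ∧ ∃ h₀ : ℤ, ∀ h ≤ h₀, ∀ p q, LastPassage (bracketType x) h p →
    LastPassage (bracketType x) (h - d) q → bracketLabel (x p) = bracketLabel (x q)}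

lemma measurableSet_periodicStackSet : MeasurableSet (periodicStackSet m) := by
  have hL := fun h p => measurableSet_setOfPred.1
    (measurable_bracketType (m := m) (measurableSet_lastPassage h p))
  refine measurableSet_setOfPred.2 ?_
  refine Measurable.exists fun d => measurable_const.and (Measurable.exists fun h₀ =>
    Measurable.forall fun h => measurable_const.imp (Measurable.forall fun p =>
    Measurable.forall fun q => (hL h p).imp ((hL _ q).imp ?_)))
  exact measurableSet_setOfPred.1 (measurableSet_eq_fun
    (measurable_bracketLabel.comp (measurable_pi_apply p))
    (measurable_bracketLabel.comp (measurable_pi_apply q)))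

lemma symmetricProduct_constant_along {k : ℕ} [NeZero k] (hk : 1 < k) {e : ℕ → ℤ}
    (he : Function.Injective e) (v : Fin k) :
    symmetricProduct k {a | ∀ t, a (e t) = v} = 0 := by
  have hlt : (k : ENNReal)⁻¹ < 1 := ENNReal.inv_lt_one.2 (by exact_mod_cast hk)
  refine le_antisymm (ge_of_tendsto' (ENNReal.tendsto_pow_atTop_nhds_zero_of_lt_one hlt)
    fun T => ?_) zero_le
  have := symmetricProduct_cylinder k ((Finset.range T).image e) (fun _ => v)
  rw [Finset.card_image_of_injective _ he, Finset.card_range] at this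
  rw [← this]
  refine measure_mono fun a ha j hj => ?_
  obtain ⟨t, -, rfl⟩ := Finset.mem_image.1 hj
  exact ha t

lemma dyckMeasure_periodicStackSet [NeZero m] (hm : 1 < m) :
    dyckMeasure m (periodicStackSet m) = 0 := by
  rw [dyckMeasure_apply measurableSet_periodicStackSet, ← lintegral_zero (μ := symmetricProduct 2)]
  refine lintegral_congr_ae ?_
  filter_upwards [ae_mem_balancedSet] with z hz
  have hex : ∀ h : ℤ, ∃ p, h < 0 → LastPassage z h p := fun h => by
    by_cases hh : h < 0
    · obtain ⟨p, h1, h2, h3⟩ := exists_last_passage hz (N := 0) (h := h) (by rwa [height_zero])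
      exact ⟨p, fun _ => ⟨h1, h2, h3⟩⟩
    · exact ⟨0, fun h => absurd h hh⟩
  choose ρ hρ using hex
  have hsub : {a | bracketMap m (z, a) ∈ periodicStackSet m} ⊆
      ⋃ (d : {d : ℕ // 0 < d}) (h : {h : ℤ // h < 0}) (v : Fin m),
        {a | ∀ t : ℕ, a (onesCount z (ρ (h - t * d))) = v} := by
    rintro a ⟨d, hd, h₀, H⟩
    rw [bracketType_bracketMap] at H
    simp only [Set.mem_iUnion]
    -- The start is negative so that every height in the progression has a last passage before the
    -- origin.
    refine ⟨⟨d, hd⟩, ⟨min h₀ (-1), by omega⟩, a (onesCount z (ρ (min h₀ (-1)))), fun t => ?_⟩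
    simp only
    induction t with
    | zero => simp
    | succ t ih =>
      rw [← ih]
      have hneg : (0 : ℤ) ≤ t * d := by positivity
      have l1 := hρ (min h₀ (-1) - t * d) (by omega)
      have l2 := hρ (min h₀ (-1) - (t + 1 : ℕ) * d) (by push_cast; rw [add_mul]; omega)
      have e : min h₀ (-1) - (t + 1 : ℕ) * (d : ℤ) = min h₀ (-1) - t * d - d := by
        push_cast; ring
      have := H (min h₀ (-1) - t * d) (by omega) _ _ l1 (e ▸ l2)
      rw [bracketLabel_bracketMap, bracketLabel_bracketMap, openPos_of_one l1.one,
        openPos_of_one (e ▸ l2.one)] at this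
      rw [this, e]
  refine measure_mono_null hsub ?_
  refine measure_iUnion_null fun d => measure_iUnion_null fun h => measure_iUnion_null fun v =>
    symmetricProduct_constant_along hm (e := fun t : ℕ => onesCount z (ρ (h - t * d)))
      (fun s t hst => ?_) v
  have hl : ∀ t : ℕ, LastPassage z (h - t * d) (ρ (h - t * d)) := fun t =>
    hρ _ (by have : (0 : ℤ) ≤ t * (d : ℕ) := by positivity
             have := h.2
             omega)
  have h1 := onesCount_injOn z (hl s).one (hl t).one hst
  have h2 := (hl s).height_eq
  rw [h1, (hl t).height_eq] at h2
  have hd : ((d : ℕ) : ℤ) ≠ 0 := by have := d.2; omega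
  have h3 : (t : ℤ) * (d : ℕ) = s * (d : ℕ) := by linarith
  exact_mod_cast (mul_right_cancel₀ hd h3).symm

/-! ### Double-tail equivalent points -/

/-- Two points differ by the exchange of an excursion. -/
def ExchangeRel (x x' : ℤ → DyckAlphabet m) : Prop :=
  ∃ r l, Excursion (bracketType x) r l ∧ Excursion (bracketType x') r l ∧
    ∀ k ∉ Finset.Ico r l, x k = x' k

lemma ExchangeRel.symm {x x' : ℤ → DyckAlphabet m} (h : ExchangeRel x x') : ExchangeRel x' x := by
  obtain ⟨r, l, h1, h2, h3⟩ := h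
  exact ⟨r, l, h2, h1, fun k hk => (h3 k hk).symm⟩

lemma DoubleTail.symm {S : Type*} {X : Set (ℤ → S)} {x x' : ℤ → S} (h : DoubleTail X x x') :
    DoubleTail X x' x := by
  obtain ⟨h1, h2, n, hn⟩ := h
  exact ⟨h2, h1, n, fun k hk => (hn k hk).symm⟩

lemma Matched.excursion {z : ℤ → Fin 2} {p q : ℤ} (h : Matched z p q) : Excursion z p (q + 1) := by
  refine ⟨by have := h.lt; omega, h.height_eq, fun j h1 h2 => ?_⟩
  rcases h1.eq_or_lt with rfl | h1
  · exact le_rfl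
  · rcases h2.eq_or_lt with rfl | h2
    · exact h.height_eq.ge
    · exact (h.lt_height j h1 (by omega)).le

/-- At low levels the opening bracket `P h` is matched in `x` with `Q h`, but in `x'` with `Q (h +
(c₁ - c₂))`. The offset `c₁ - c₂` decides between the two alternatives. -/
lemma DoubleTail.exchangeRel_or_mem {x x' : ℤ → DyckAlphabet m}
    (h : DoubleTail (dyckShift m) x x') (hz : bracketType x ∈ balancedSet) :
    ExchangeRel x x' ∨ x ∈ periodicStackSet m := by
  obtain ⟨hx, hx', n, hn⟩ := h
  set z := bracketType x with hzdef
  set z' := bracketType x' with hzdef'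
  have hzz : ∀ k, k < -(n : ℤ) ∨ (n : ℤ) < k → z k = z' k := fun k hk => by
    have := hn k (by rw [lt_abs]; omega)
    simp only [hzdef, hzdef', bracketType, this]
  obtain ⟨c₁, hc₁⟩ : ∃ c, ∀ k ≤ -(n : ℤ), height z' k = height z k + c :=
    ⟨height z' (-n) - height z (-n), fun k hk => by
      have := height_sub_congr (z := z) (z' := z') hk fun j _ hj => hzz j (Or.inl hj)
      omega⟩
  obtain ⟨c₂, hc₂⟩ : ∃ c, ∀ k ≥ (n : ℤ) + 1, height z' k = height z k + c :=
    ⟨height z' (n + 1) - height z (n + 1), fun k hk => by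
      have := height_sub_congr (z := z) (z' := z') hk fun j hj _ => hzz j (Or.inr (by omega))
      omega⟩
  -- Below the level `h₀` neither point is affected by what happens in the window where they may
  -- differ.
  obtain ⟨h₀, hh₀, hh₀'⟩ : ∃ h₀ : ℤ, (∀ j ∈ Finset.Icc (-(n : ℤ)) (n + 1), h₀ < height z j) ∧
      ∀ j ∈ Finset.Icc (-(n : ℤ)) (n + 1), h₀ + c₁ < height z' j := by
    obtain ⟨a, ha⟩ := ((Finset.Icc (-(n : ℤ)) (n + 1)).image (height z)).bddBelow
    obtain ⟨b, hb⟩ := ((Finset.Icc (-(n : ℤ)) (n + 1)).image (height z')).bddBelow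
    refine ⟨min (a - 1) (b - c₁ - 1), fun j hj => ?_, fun j hj => ?_⟩
    · have := ha (Finset.mem_coe.2 (Finset.mem_image_of_mem _ hj)); omega
    · have := hb (Finset.mem_coe.2 (Finset.mem_image_of_mem _ hj)); omega
  simp only [Finset.mem_Icc] at hh₀ hh₀'
  have hlast : ∀ h, ∃ p, h ≤ h₀ → p < -(n : ℤ) ∧ height z p = h ∧
      ∀ j, p < j → j ≤ -(n : ℤ) → h < height z j := fun h => by
    by_cases hh : h ≤ h₀
    · obtain ⟨p, hp⟩ := exists_last_passage hz (N := -n) (h := h)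
        (hh.trans_lt (hh₀ _ (by omega)))
      exact ⟨p, fun _ => hp⟩
    · exact ⟨0, fun H => absurd H hh⟩
  have hfirst : ∀ h, ∃ q, h ≤ h₀ → q ≥ (n : ℤ) + 1 ∧ height z (q + 1) = h ∧
      ∀ j, (n : ℤ) + 1 ≤ j → j ≤ q → h < height z j := fun h => by
    by_cases hh : h ≤ h₀
    · obtain ⟨q, hq⟩ := exists_first_passage hz (N := n + 1) (h := h)
        (hh.trans_lt (hh₀ _ (by omega)))
      exact ⟨q, fun _ => hq⟩
    · exact ⟨0, fun H => absurd H hh⟩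
  choose P hP using hlast
  choose Q hQ using hfirst
  have hmatch : ∀ h ≤ h₀, Matched z (P h) (Q h) := fun h hh => by
    obtain ⟨p1, p2, p3⟩ := hP h hh
    obtain ⟨q1, q2, q3⟩ := hQ h hh
    refine ⟨by omega, by omega, fun j h1 h2 => ?_⟩
    rw [p2]
    by_cases h3 : j ≤ -(n : ℤ)
    · exact p3 j h1 h3
    · by_cases h4 : (n : ℤ) + 1 ≤ j
      · exact q3 j h4 h2
      · exact hh.trans_lt (hh₀ j (by omega))
  have hmatch' : ∀ h ≤ h₀, h + (c₁ - c₂) ≤ h₀ → Matched z' (P h) (Q (h + (c₁ - c₂))) :=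
    fun h hh hh' => by
      obtain ⟨p1, p2, p3⟩ := hP h hh
      obtain ⟨q1, q2, q3⟩ := hQ _ hh'
      have e1 := hc₁ (P h) (by omega)
      have e2 := hc₂ (Q (h + (c₁ - c₂)) + 1) (by omega)
      refine ⟨by omega, by omega, fun j h1 h2 => ?_⟩
      by_cases h3 : j ≤ -(n : ℤ)
      · have := p3 j h1 h3
        have := hc₁ j h3
        omega
      · by_cases h4 : (n : ℤ) + 1 ≤ j
        · have := q3 j h4 h2
          have := hc₂ j h4
          omega
        · have := hh₀' j (by omega)
          omega
  have hPlast : ∀ h ≤ h₀, LastPassage z h (P h) := fun h hh => by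
    obtain ⟨p1, p2, p3⟩ := hP h hh
    refine ⟨by omega, p2, fun j h1 h2 => ?_⟩
    by_cases h3 : j ≤ -(n : ℤ)
    · exact p3 j h1 h3
    · exact hh.trans_lt (hh₀ j (by omega))
  -- Go from `P h` to its partner in `x'`, and from there back to the partner's opening bracket in
  -- `x`; all these positions lie where the two points agree.
  have hlabel : ∀ h ≤ h₀, h + (c₁ - c₂) ≤ h₀ →
      bracketLabel (x (P h)) = bracketLabel (x (P (h + (c₁ - c₂)))) := fun h hh hh' => by
    have e1 := (hmatch' h hh hh').bracketLabel_eq hx'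
    have e2 := (hmatch _ hh').bracketLabel_eq hx
    have p1 := (hP h hh).1
    have q1 := (hQ _ hh').1
    rw [hn (P h) (by rw [lt_abs]; omega), e1, e2, hn (Q _) (by rw [lt_abs]; omega)]
  rcases lt_trichotomy (c₁ - c₂) 0 with hd | hd | hd
  · refine Or.inr ⟨(c₁ - c₂).natAbs, by omega, h₀, fun h hh p q hp hq => ?_⟩
    have e : h - (c₁ - c₂).natAbs = h + (c₁ - c₂) := by omega
    rw [e] at hq
    rw [hp.unique (hPlast h hh), hq.unique (hPlast _ (by omega))]
    exact hlabel h hh (by omega)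
  · left
    have h1 := hmatch h₀ le_rfl
    have h2 := hmatch' h₀ le_rfl (by omega)
    rw [hd, add_zero] at h2
    refine ⟨_, _, h1.excursion, h2.excursion, fun k hk => hn k ?_⟩
    rw [Finset.mem_Ico] at hk
    have p1 := (hP h₀ le_rfl).1
    have q1 := (hQ h₀ le_rfl).1
    rw [lt_abs]
    omega
  · refine Or.inr ⟨(c₁ - c₂).natAbs, by omega, h₀, fun h hh p q hp hq => ?_⟩
    have e : h - (c₁ - c₂).natAbs + (c₁ - c₂) = h := by omega
    rw [hp.unique (hPlast h hh), hq.unique (hPlast _ (by omega))]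
    have := hlabel (h - (c₁ - c₂).natAbs) (by omega) (by omega)
    rw [e] at this
    exact this.symm

/-! ### Invariance under holonomies -/

/-- An injective map that preserves the measure of all measurable subsets of countably many pieces
preserves the measure of their union. -/
lemma measure_image_iUnion_eq {α ι : Type*} [MeasurableSpace α] [Countable ι] {μ : Measure α}
    {g : α → α} {P : ι → Set α} (hP : ∀ i, MeasurableSet (P i)) (hg : Set.InjOn g (⋃ i, P i))
    (h : ∀ i, ∀ B ⊆ P i, MeasurableSet B → MeasurableSet (g '' B) ∧ μ (g '' B) = μ B) :
    μ (g '' ⋃ i, P i) = μ (⋃ i, P i) := by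
  cases isEmpty_or_nonempty ι
  · simp
  obtain ⟨f, hf⟩ := exists_surjective_nat ι
  -- The pieces may overlap, so they are first made disjoint; injectivity then makes their images
  -- disjoint.
  have e : ⋃ i, P i = ⋃ n, disjointed (P ∘ f) n := by
    rw [iUnion_disjointed]
    exact (hf.iUnion_comp P).symm
  have hD : ∀ n, MeasurableSet (disjointed (P ∘ f) n) := fun n =>
    MeasurableSet.disjointed (fun k => hP (f k)) n
  have hsub : ∀ n, disjointed (P ∘ f) n ⊆ P (f n) := fun n => disjointed_subset _ n
  rw [e] at hg ⊢
  rw [Set.image_iUnion, measure_iUnion _ fun n => (h _ _ (hsub n) (hD n)).1,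
    measure_iUnion (disjoint_disjointed _) hD]
  · exact tsum_congr fun n => (h _ _ (hsub n) (hD n)).2
  · intro i j hij
    refine Set.disjoint_left.2 ?_
    rintro _ ⟨x, hx, rfl⟩ ⟨y, hy, hxy⟩
    have := hg (Set.mem_iUnion_of_mem j hy) (Set.mem_iUnion_of_mem i hx) hxy
    subst this
    exact Set.disjoint_left.1 (disjoint_disjointed _ hij) hx hy

/-- The part of `A` where `g` replaces the word `u` on `[r, l)` by `v`. -/
def exchangePiece (A : Set (ℤ → DyckAlphabet m)) (g : (ℤ → DyckAlphabet m) → ℤ → DyckAlphabet m)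
    (r l : ℤ) (u v : Finset.Ico r l → DyckAlphabet m) : Set (ℤ → DyckAlphabet m) :=
  {x ∈ A | (∀ n : Finset.Ico r l, x n = u n ∧ g x n = v n) ∧
    ∀ n ∉ Finset.Ico r l, g x n = x n}

lemma measurableSet_exchangePiece {A : Set (ℤ → DyckAlphabet m)}
    {g : (ℤ → DyckAlphabet m) → ℤ → DyckAlphabet m} (hA : MeasurableSet A)
    (hg : Measurable (A.domRestrict g)) (r l : ℤ) (u v : Finset.Ico r l → DyckAlphabet m) :
    MeasurableSet (exchangePiece A g r l u v) := by
  have e : exchangePiece A g r l u v = Subtype.val '' {x : A |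
      (∀ n : Finset.Ico r l, (x : ℤ → DyckAlphabet m) n = u n ∧ A.domRestrict g x n = v n) ∧
        ∀ n, n ∉ Finset.Ico r l → A.domRestrict g x n = (x : ℤ → DyckAlphabet m) n} := by
    ext x
    constructor
    · rintro ⟨h1, h2⟩
      exact ⟨⟨x, h1⟩, h2, rfl⟩
    · rintro ⟨⟨x, h1⟩, h2, rfl⟩
      exact ⟨h1, h2⟩
  rw [e]
  refine hA.subtype_image ?_
  have hg' : ∀ n, Measurable fun x : A => A.domRestrict g x n := fun n =>
    (measurable_pi_apply n).comp hg
  have hx' : ∀ n, Measurable fun x : A => (x : ℤ → DyckAlphabet m) n := fun n =>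
    (measurable_pi_apply n).comp measurable_subtype_coe
  refine measurableSet_setOfPred.2 (Measurable.and ?_ ?_)
  · exact Measurable.forall fun n =>
      (measurableSet_setOfPred.1 (measurableSet_eq_fun (hx' n) measurable_const)).and
        (measurableSet_setOfPred.1 (measurableSet_eq_fun (hg' n) measurable_const))
  · exact Measurable.forall fun n => measurable_const.imp
      (measurableSet_setOfPred.1 (measurableSet_eq_fun (hg' n) (hx' n)))

lemma dyckMeasure_image_of_subset_exchangePiece [NeZero m] {A : Set (ℤ → DyckAlphabet m)}
    {g : (ℤ → DyckAlphabet m) → ℤ → DyckAlphabet m} {r l : ℤ}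
    {u v : Finset.Ico r l → DyckAlphabet m} {x : ℤ → DyckAlphabet m}
    (hx : x ∈ exchangePiece A g r l u v) (hxX : x ∈ dyckShift m) (hgX : g x ∈ dyckShift m)
    (h : Excursion (bracketType x) r l) (h' : Excursion (bracketType (g x)) r l)
    {B : Set (ℤ → DyckAlphabet m)} (hB : B ⊆ exchangePiece A g r l u v) (hBm : MeasurableSet B) :
    MeasurableSet (g '' B) ∧ dyckMeasure m (g '' B) = dyckMeasure m B := by
  have e : g '' B = (fun t => (Finset.Ico r l).piecewise (g x) t) '' B := by
    refine Set.image_congr fun t ht => funext fun n => ?_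
    obtain ⟨-, h1, h2⟩ := hB ht
    by_cases hn : n ∈ Finset.Ico r l
    · rw [Finset.piecewise_eq_of_mem _ _ _ hn, (h1 ⟨n, hn⟩).2, (hx.2.1 ⟨n, hn⟩).2]
    · rw [Finset.piecewise_eq_of_notMem _ _ _ hn, h2 n hn]
  rw [e]
  exact dyckMeasure_image_exchange hxX hgX h h' hBm fun t ht n hn => by
    rw [((hB ht).2.1 ⟨n, hn⟩).1, (hx.2.1 ⟨n, hn⟩).1]

lemma dyckMeasure_image_eq [NeZero m] (hm : 1 < m) {A : Set (ℤ → DyckAlphabet m)}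
    {g : (ℤ → DyckAlphabet m) → ℤ → DyckAlphabet m}
    (hg : IsDoubleTailHolonomy (dyckShift m) A g) :
    dyckMeasure m A = dyckMeasure m (g '' A) := by
  -- Countably many indices: an interval with the old and the new word on it, kept only if some
  -- point of the piece witnesses that both words are excursions.
  let ι := {i : Σ p : ℤ × ℤ, (Finset.Ico p.1 p.2 → DyckAlphabet m) ×
      (Finset.Ico p.1 p.2 → DyckAlphabet m) //
    ∃ x ∈ exchangePiece A g i.1.1 i.1.2 i.2.1 i.2.2, Excursion (bracketType x) i.1.1 i.1.2 ∧
      Excursion (bracketType (g x)) i.1.1 i.1.2}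
  let P : ι → Set (ℤ → DyckAlphabet m) := fun i =>
    exchangePiece A g i.1.1.1 i.1.1.2 i.1.2.1 i.1.2.2
  have hPA : ⋃ i, P i ⊆ A := Set.iUnion_subset fun i x hx => hx.1
  have hP : ∀ i, MeasurableSet (P i) := fun i =>
    measurableSet_exchangePiece hg.measurableSet hg.measurable _ _ _ _
  have hmain : dyckMeasure m (g '' ⋃ i, P i) = dyckMeasure m (⋃ i, P i) := by
    refine measure_image_iUnion_eq hP (hg.injOn.mono hPA) fun i B hB hBm => ?_
    obtain ⟨x, hx, h, h'⟩ := i.2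
    obtain ⟨hxX, hgX, -⟩ := hg.rel x hx.1
    exact dyckMeasure_image_of_subset_exchangePiece hx hxX hgX h h' hB hBm
  -- By symmetry of both relations, a point and its image that do not differ by an exchange both lie
  -- in `Z`; so the exceptional part of `A` and its image are both null.
  let Z : Set (ℤ → DyckAlphabet m) := {x | bracketType x ∉ balancedSet} ∪ periodicStackSet m
  have hZ : dyckMeasure m Z = 0 :=
    measure_union_null (ae_bracketType_mem_balancedSet m) (dyckMeasure_periodicStackSet hm)
  have hmemZ : ∀ x x', DoubleTail (dyckShift m) x x' → ¬ ExchangeRel x x' → x ∈ Z :=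
    fun x x' h h' => by
      by_cases hb : bracketType x ∈ balancedSet
      · exact Or.inr ((h.exchangeRel_or_mem hb).resolve_left h')
      · exact Or.inl hb
  have hN : ∀ x ∈ A \ ⋃ i, P i, ¬ ExchangeRel x (g x) := by
    rintro x ⟨hxA, hx⟩ ⟨r, l, h, h', hoff⟩
    have hxp : x ∈ exchangePiece A g r l (fun n => x n) (fun n => g x n) :=
      ⟨hxA, fun n => ⟨rfl, rfl⟩, fun n hn => (hoff n hn).symm⟩
    exact hx (Set.mem_iUnion.2 ⟨⟨⟨(r, l), fun n => x n, fun n => g x n⟩, x, hxp, h, h'⟩, hxp⟩)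
  have h1 : dyckMeasure m (A \ ⋃ i, P i) = 0 :=
    measure_mono_null (fun x hx => hmemZ x (g x) (hg.rel x hx.1) (hN x hx)) hZ
  have h2 : dyckMeasure m (g '' (A \ ⋃ i, P i)) = 0 := by
    refine measure_mono_null ?_ hZ
    rintro _ ⟨x, hx, rfl⟩
    exact hmemZ (g x) x (hg.rel x hx.1).symm fun H => hN x hx H.symm
  have e : A = (⋃ i, P i) ∪ (A \ ⋃ i, P i) := (Set.union_sdiff_cancel hPA).symm
  have e1 : dyckMeasure m A = dyckMeasure m (⋃ i, P i) := by
    conv_lhs => rw [e]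
    exact measure_congr (union_ae_eq_left_of_ae_eq_empty (ae_eq_empty.2 h1))
  have e2 : dyckMeasure m (g '' A) = dyckMeasure m (g '' ⋃ i, P i) := by
    conv_lhs => rw [e, Set.image_union]
    exact measure_congr (union_ae_eq_left_of_ae_eq_empty (ae_eq_empty.2 h2))
  rw [e1, e2, hmain]

end

theorem mainTheorem1 (m : ℕ) [NeZero m] (hm : 1 < m) :
    IsDoubleTailInvariantProbability (dyckShift m) (dyckMeasure m) := by
  exact ⟨inferInstance, dyckMeasure_dyckShift m, fun _ _ hg => dyckMeasure_image_eq hm hg⟩
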